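/- **Setting.** Let $m,c,\omega_0,\hbar,k_B,T>0$ and $e,B\in\mathbb R$, and put $\omega_c=eB/(mc)$. Let $\mu$ be a real causal friction kernel on $[0,\infty)$, the sum of a point mass $\eta\,\delta_0$ at time $0$ (Ohmic part; total mass $\eta\in\mathbb R$) and an integrable function $k$ on $(0,\infty)$, with Fourier transform $\tilde\mu(\omega)=\eta+\int_0^\infty k(s)e^{-i\omega s}\,ds$, $\tilde\gamma=\tilde\mu/m$, and suppose $\mathrm{Re}\,\tilde\mu(\omega)>0$ for all real $\omega\neq0$. Let $\langle\cdot\rangle$ be a state (normalized positive linear functional) on a unital complex $*$-algebra of operators. Let $\mathbf f=(f_x,f_y)$ be the thermal noise of the bath at temperature $T$: self-adjoint operator-valued distributions on the line (with real Schwartz test functions) with $$\langle\{f_\alpha(t),f_\beta(t')\}\rangle=\frac{2\delta_{\alpha\beta}}{\pi}\int_0^\infty \hbar\omega\,\mathrm{Re}[\tilde\mu(\omega)]\coth\Big(\frac{\hbar\omega}{2k_BT}\Big)\cos[\omega(t-t')]\,d\omega,$$ $$\langle[f_\alpha(t),f_\beta(t')]\rangle=\frac{2\delta_{\alpha\beta}}{i\pi}\int_0^\infty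 \hbar\omega\,\mathrm{Re}[\tilde\mu(\omega)]\sin[\omega(t-t')]\,d\omega$$ in the sense of distributions. A steady state is a self-adjoint operator-valued, mean-square continuous process $\mathbf r(t)=(x(t),y(t))$, $t\in\mathbb R$, whose two-time correlations $\langle r_\alpha(s)r_\beta(t)\rangle$ depend only on $s-t$, and which satisfies, in the sense of distributions in $t$ and of expectations $\langle a\,\cdot\,\rangle$ against every observable $a$, the quantum Langevin equation of a charged oscillator in the field $\mathbf B=B\hat z$, $$m\ddot{\mathbf r}(t)+\int_{-\infty}^t\mu(t-t')\dot{\mathbf r}(t')\,dt'+m\omega_0^2\mathbf r(t)-\frac ec\,\dot{\mathbf r}(t)\times\mathbf B=\mathbf f(t).$$ **Theorem 1.** In every steady state the following holds. If the velocity $\dot{\mathbf r}=(\dot x,\dot y)$ exists as a self-adjoint operator-valued mean-square derivative of $\mathbf r$, then for every $t$ the mean kinetic energy $E_k=\frac m2\langle\dot x(t)^2+\dot y(t)^2\rangle$ is $$E_k=\frac1{2\pi}\int_{-\infty}^{\infty}d\omega\,\mathcal E_k(\omega)\,\omega^2\,[\Phi(\omega)+\Phi(-\omega)],$$ where the integral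 converges absolutely, and $$\mathcal E_k(\omega)=\frac{\hbar\omega}2\coth\Big(\frac{\hbar\omega}{2k_BT}\Big),\qquad \Phi(\omega)=\frac{\mathrm{Re}[\tilde\gamma(\omega)]}{\big(\omega^2-\omega_0^2-\omega\omega_c+\omega\,\mathrm{Im}[\tilde\gamma(\omega)]\big)^2+\big(\omega\,\mathrm{Re}[\tilde\gamma(\omega)]\big)^2}.$$ Without assuming that the velocity exists (it may have infinite mean square, as for purely Ohmic friction), the same formula holds in $[0,\infty]$ with $E_k$ read as $\lim_{h\to0}\frac m2\big\langle\big(\tfrac{x(t+h)-x(t)}h\big)^2+\big(\tfrac{y(t+h)-y(t)}h\big)^2\big\rangle$, for every $t$. -/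

import Mathlib

open MeasureTheory Set Filter Topology
open scoped SchwartzMap

noncomputable section

namespace Magneto

/-- The constants of the model: mass `m`, charge `e`, field strength `B` (the field is `B ẑ`),
speed of light `c`, trap frequency `ω₀`, and `ħ`, `k_B`, temperature `T`. -/
structure Params where
  m : ℝ
  e : ℝ
  B : ℝ
  c : ℝ
  ω₀ : ℝ
  ħ : ℝ
  kB : ℝ
  T : ℝ
  m_pos : 0 < m
  c_pos : 0 < c
  ω₀_pos : 0 < ω₀
  ħ_pos : 0 < ħ
  kB_pos : 0 < kB
  T_pos : 0 < T

/-- The cyclotron frequency `eB / mc`. -/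
def Params.ωc (p : Params) : ℝ := p.e * p.B / (p.m * p.c)

/-- The real hyperbolic cotangent (its value at `0` is irrelevant below: it only occurs under
integrals over frequency). -/
def coth (x : ℝ) : ℝ := Real.cosh x / Real.sinh x

/-- A causal friction kernel `μ`, carried by `[0, ∞)`: an instantaneous (Ohmic) part of total
mass `inst` concentrated at time `0`, plus an integrable memory function `mem` on `(0, ∞)`. Thus
`∫_{-∞}^t μ(t - t') u(t') dt' = inst * u(t) + ∫_0^∞ mem(s) u(t - s) ds`. -/
structure FrictionKernel where
  inst : ℝ
  mem : ℝ → ℝ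
  integrable_mem : IntegrableOn mem (Ioi 0)

/-- The Fourier transform `μ̃(ω) = ∫_0^∞ μ(s) e^{-iωs} ds` of the friction kernel. -/
def FrictionKernel.ft (μ : FrictionKernel) (ω : ℝ) : ℂ :=
  (μ.inst : ℂ) + ∫ s in Ioi (0 : ℝ), (μ.mem s : ℂ) * Complex.exp (-(Complex.I * ω * s))

/-- The Fourier transform `γ̃ = μ̃ / m` of the friction kernel per unit mass. -/
def gammaFT (p : Params) (μ : FrictionKernel) (ω : ℝ) : ℂ := μ.ft ω / (p.m : ℂ)

/-- `ℰ_k(ω) = (ħω/2) coth (ħω / 2 k_B T)`. -/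
def bathEnergy (p : Params) (ω : ℝ) : ℝ :=
  p.ħ * ω / 2 * coth (p.ħ * ω / (2 * p.kB * p.T))

/-- The relaxation function `Φ(ω)`. -/
def relaxation (p : Params) (μ : FrictionKernel) (ω : ℝ) : ℝ :=
  (gammaFT p μ ω).re /
    ((ω ^ 2 - p.ω₀ ^ 2 - ω * p.ωc + ω * (gammaFT p μ ω).im) ^ 2
      + (ω * (gammaFT p μ ω).re) ^ 2)

/-- The density `(1/2π) ℰ_k(ω) ω² [Φ(ω) + Φ(-ω)]`. -/
def energyDensity (p : Params) (μ : FrictionKernel) (ω : ℝ) : ℝ :=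
  1 / (2 * Real.pi) *
    (bathEnergy p ω * ω ^ 2 * (relaxation p μ ω + relaxation p μ (-ω)))

section Quantum

variable {A : Type*} [Ring A] [StarRing A] [Algebra ℂ A] [StarModule ℂ A]

/-- A state on the unital complex `*`-algebra `A` of (possibly unbounded) operators: a normalized
positive linear functional, the thermal average `⟨·⟩`. -/
structure QuantumState (A : Type*) [Ring A] [StarRing A] [Algebra ℂ A] where
  expect : A →ₗ[ℂ] ℂ
  expect_one : expect 1 = 1
  re_nonneg : ∀ a, 0 ≤ (expect (star a * a)).re
  im_eq_zero : ∀ a, (expect (star a * a)).im = 0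

/-- The mean square `⟨a† a⟩`. -/
def QuantumState.meanSq (E : QuantumState A) (a : A) : ℝ := (E.expect (star a * a)).re

/-- The operator-valued thermal noise `f = (f_x, f_y)` of the quantum Langevin equation, as an
operator-valued distribution: `f i g` stands for `∫ f_i(t) g(t) dt`. It consists of self-adjoint
elements, and its symmetric correlation and its commutator are
`⟨{f_i(t), f_j(t')}⟩ = (2 δ_ij/π) ∫_0^∞ ħω Re μ̃(ω) coth(ħω/2k_BT) cos(ω(t-t')) dω` and
`⟨[f_i(t), f_j(t')]⟩ = (2 δ_ij/(iπ)) ∫_0^∞ ħω Re μ̃(ω) sin(ω(t-t')) dω`,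
both smeared with test functions. -/
structure IsThermalNoise (p : Params) (μ : FrictionKernel) (E : QuantumState A)
    (f : Fin 2 → 𝓢(ℝ, ℝ) →ₗ[ℝ] A) : Prop where
  selfAdjoint : ∀ i g, IsSelfAdjoint (f i g)
  anticommutator : ∀ i j g h,
    E.expect (f i g * f j h + f j h * f i g) =
      if i = j then
        2 / (Real.pi : ℂ) *
          ((∫ ω in Ioi (0 : ℝ), p.ħ * ω * (μ.ft ω).re * coth (p.ħ * ω / (2 * p.kB * p.T)) *
            ∫ t, ∫ t', g t * h t' * Real.cos (ω * (t - t')) : ℝ) : ℂ)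
      else 0
  commutator : ∀ i j g h,
    E.expect (f i g * f j h - f j h * f i g) =
      if i = j then
        2 / (Complex.I * (Real.pi : ℂ)) *
          ((∫ ω in Ioi (0 : ℝ), p.ħ * ω * (μ.ft ω).re *
            ∫ t, ∫ t', g t * h t' * Real.sin (ω * (t - t')) : ℝ) : ℂ)
      else 0

/-- The vector product `u × (B ẑ)` for a planar vector `u = (u_x, u_y)`. -/
def crossField (B : ℝ) (u : Fin 2 → ℂ) : Fin 2 → ℂ := ![(B : ℂ) * u 1, -((B : ℂ) * u 0)]

/-- The quantum Langevin equation
`m r̈(t) + ∫_{-∞}^t μ(t-t') ṙ(t') dt' + m ω₀² r(t) - (e/c) ṙ(t) × B ẑ = f(t)`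
for operator-valued `r = (x, y)`, in the sense of distributions in time and of expectations
`⟨a ·⟩` against arbitrary observables `a` (all derivatives are moved onto the test function `g`;
the memory term is `d/dt ∫ μ(s) r(t-s) ds`). -/
def SolvesLangevin (p : Params) (μ : FrictionKernel) (E : QuantumState A)
    (f : Fin 2 → 𝓢(ℝ, ℝ) →ₗ[ℝ] A) (r : Fin 2 → ℝ → A) : Prop :=
  ∀ (a : A) (i : Fin 2) (g : 𝓢(ℝ, ℝ)),
    (∫ t, (p.m : ℂ) * E.expect (a * r i t) * ((iteratedDeriv 2 (fun u => g u) t : ℝ) : ℂ))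
      - (∫ t, ((μ.inst : ℂ) * E.expect (a * r i t)
            + ∫ s in Ioi (0 : ℝ), (μ.mem s : ℂ) * E.expect (a * r i (t - s))) * ((deriv (fun u => g u) t : ℝ) : ℂ))
      + (∫ t, (p.m * p.ω₀ ^ 2 : ℂ) * E.expect (a * r i t) * ((g t : ℝ) : ℂ))
      + (∫ t, (p.e / p.c : ℂ) * crossField p.B (fun j => E.expect (a * r j t)) i
            * ((deriv (fun u => g u) t : ℝ) : ℂ))
      = E.expect (a * f i g)

/-- A steady state of the Langevin dynamics: a self-adjoint position process `r = (x, y)` on the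
whole time axis, mean-square continuous, solving the quantum Langevin equation, with two-time
correlations invariant under time translation. -/
structure IsSteadyState (p : Params) (μ : FrictionKernel) (E : QuantumState A)
    (f : Fin 2 → 𝓢(ℝ, ℝ) →ₗ[ℝ] A) (r : Fin 2 → ℝ → A) : Prop where
  selfAdjoint : ∀ i t, IsSelfAdjoint (r i t)
  continuous : ∀ i t, Tendsto (fun s => E.meanSq (r i s - r i t)) (𝓝 t) (𝓝 0)
  stationary : ∀ i j s t τ,
    E.expect (r i (s + τ) * r j (t + τ)) = E.expect (r i s * r j t)
  langevin : SolvesLangevin p μ E f r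

/-- The difference quotient `(r_i(t+h) - r_i(t)) / h`. -/
def diffQuot (r : Fin 2 → ℝ → A) (i : Fin 2) (t h : ℝ) : A :=
  ((h⁻¹ : ℝ) : ℂ) • (r i (t + h) - r i t)

/-- `v = ṙ`: a self-adjoint velocity process that is the mean-square derivative of `r`. -/
structure IsVelocity (E : QuantumState A) (r v : Fin 2 → ℝ → A) : Prop where
  selfAdjoint : ∀ i t, IsSelfAdjoint (v i t)
  hasDeriv : ∀ i t, Tendsto (fun h => E.meanSq (diffQuot r i t h - v i t)) (𝓝[≠] 0) (𝓝 0)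

/-- The mean kinetic energy `(m/2) ⟨ẋ(t)² + ẏ(t)²⟩`. -/
def kineticEnergy (p : Params) (E : QuantumState A) (v : Fin 2 → ℝ → A) (t : ℝ) : ℂ :=
  (p.m / 2 : ℂ) * E.expect (v 0 t ^ 2 + v 1 t ^ 2)

end Quantum

end Magneto

end

/-! The circular components `x + iσy`, `σ = ±1`, decouple the Langevin equation into scalar ones. By
stationarity and mean-square continuity, each is a continuous stationary curve in the GNS Hilbert
space, so by Bochner and Khinchin (`exists_charFun_eq_correlation`) its correlation is the Fourier
transform of a finite measure `ρ`. On the spectral side the Langevin operator multiplies by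
`langevinSymbol`. Inserting the equation in both slots of the force correlation
(`IsSteadyState.expect_force`) shows that the force has spectral measure `|symbol|² ρ`, while the
thermal noise prescribes the density `2 * noiseDensity` (`IsThermalNoise.expect_circ`).

Comparing the two on a Gaussian test function and its translates gives equality of characteristic
functions of two finite measures. The symbol has no real zero, since friction is positive off
frequency zero and the trap is positive at zero. It can therefore be divided out, and `ρ` is
absolutely continuous with explicit density (`lintegral_spectralMeasure`). No dynamical assumption
on relaxation is needed: an undamped homogeneous part would require a zero of the symbol.

The energy of a difference quotient is then the integral of `sinc² (hω/2)` times the kinetic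
density. The integrand is dominated by its own limit, so the integrals converge in `[0, ∞]` even
when the limit is infinite. Replacing `ω` by `-ω` removes the commutator part and leaves the `coth`
formula. If a mean-square velocity exists, the same limit is its finite energy, which yields
integrability. -/

noncomputable section

namespace Magneto

/-! ### States: hermiticity, the GNS space, Cauchy-Schwarz. -/

namespace QuantumState

variable {A : Type*} [Ring A] [StarRing A] [Algebra ℂ A] [StarModule ℂ A] (E : QuantumState A)

/-- Hermiticity follows from the reality of `⟨b† b⟩`: taking `b = 1 + a` kills the imaginary part of
`⟨a⟩ + ⟨a†⟩`, and `b = 1 + i a` kills the real part of `⟨a⟩ - ⟨a†⟩`. -/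
theorem conj_expect (a : A) : (starRingEnd ℂ) (E.expect a) = E.expect (star a) := by
  have h1 := E.im_eq_zero (1 + a)
  have h2 := E.im_eq_zero (1 + Complex.I • a)
  have h0 := E.im_eq_zero a
  have h3 : E.expect (star (1 + a) * (1 + a)) =
      1 + E.expect a + E.expect (star a) + E.expect (star a * a) := by
    rw [← E.expect_one, ← map_add, ← map_add, ← map_add]
    congr 1
    simp [add_mul, mul_add]
    abel
  have h4 : E.expect (star (1 + Complex.I • a) * (1 + Complex.I • a)) =
      1 + Complex.I * E.expect a - Complex.I * E.expect (star a) + E.expect (star a * a) := by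
    have : star (1 + Complex.I • a) * (1 + Complex.I • a) =
        1 + Complex.I • a - Complex.I • star a + star a * a := by
      simp [add_mul, mul_add, smul_smul]
      abel
    rw [this]
    simp [E.expect_one]
  rw [h3] at h1
  rw [h4] at h2
  simp at h1 h2
  apply Complex.ext <;> simp <;> linarith

/-- The semi-inner product `⟨a† b⟩` of the Gelfand-Naimark-Segal construction. -/
@[reducible]
def preInnerCore : PreInnerProductSpace.Core ℂ A where
  inner a b := E.expect (star a * b)
  conj_inner_symm a b := by simp [conj_expect]
  re_inner_nonneg a := E.re_nonneg a
  add_left a b c := by simp [add_mul]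
  smul_left a b z := by simp

/-- Gelfand-Naimark-Segal: the semi-inner product of a state is realized in a Hilbert space. -/
theorem exists_gns.{u} {A : Type u} [Ring A] [StarRing A] [Algebra ℂ A] [StarModule ℂ A]
    (E : QuantumState A) :
    ∃ (H : Type u) (_ : NormedAddCommGroup H) (_ : InnerProductSpace ℂ H) (_ : CompleteSpace H)
      (ι : A →ₗ[ℂ] H), ∀ a b, inner ℂ (ι a) (ι b) = E.expect (star a * b) := by
  let _ : SeminormedAddCommGroup A :=
    InnerProductSpace.Core.toSeminormedAddCommGroup (c := E.preInnerCore)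
  let _ : InnerProductSpace ℂ A := InnerProductSpace.ofCore E.preInnerCore
  refine ⟨UniformSpace.Completion A, inferInstance, inferInstance, inferInstance,
    (UniformSpace.Completion.toComplₗᵢ (𝕜 := ℂ) (E := A)).toLinearMap, fun a b => ?_⟩
  exact UniformSpace.Completion.inner_coe a b

omit [StarModule ℂ A] in
theorem meanSq_nonneg (a : A) : 0 ≤ E.meanSq a := E.re_nonneg a

omit [StarModule ℂ A] in
theorem expect_star_mul_self (a : A) : E.expect (star a * a) = (E.meanSq a : ℂ) :=
  Complex.ext rfl (by simpa using E.im_eq_zero a)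

/-- Cauchy-Schwarz. -/
theorem norm_expect_mul_sq_le (a b : A) :
    ‖E.expect (a * b)‖ ^ 2 ≤ E.meanSq (star a) * E.meanSq b := by
  obtain ⟨H, _, _, _, ι, hι⟩ := E.exists_gns
  have h := norm_inner_le_norm (𝕜 := ℂ) (ι (star a)) (ι b)
  have hn : ∀ a, ‖ι a‖ ^ 2 = E.meanSq a := fun a => by
    rw [@norm_sq_eq_re_inner ℂ]; rw [hι]; rfl
  rw [hι, star_star] at h
  rw [← hn, ← hn, ← mul_pow]
  gcongr

/-- The mean square is continuous along mean-square convergent families. -/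
theorem tendsto_meanSq {α : Type*} {l : Filter α} {u : α → A} {v : A}
    (h : Tendsto (fun x => E.meanSq (u x - v)) l (𝓝 0)) :
    Tendsto (fun x => E.meanSq (u x)) l (𝓝 (E.meanSq v)) := by
  obtain ⟨H, _, _, _, ι, hι⟩ := E.exists_gns
  have hn : ∀ a, E.meanSq a = ‖ι a‖ ^ 2 := fun a => by
    rw [@norm_sq_eq_re_inner ℂ]; rw [hι]; rfl
  simp only [hn, map_sub] at h ⊢
  refine Tendsto.pow (Tendsto.norm ?_) 2
  rw [tendsto_iff_norm_sub_tendsto_zero]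
  simpa [Real.sqrt_sq (norm_nonneg _)] using h.sqrt

end QuantumState

/-! ### Bochner's theorem for stationary curves in a Hilbert space. -/

open scoped FourierTransform ComplexConjugate

/-- An integrable function with nonnegative Fourier transform, continuous at `0`, has an integrable
Fourier transform. -/
theorem integrable_fourier_of_nonneg {f : ℝ → ℂ} (hf : Integrable f) (hf0 : ContinuousAt f 0)
    {S : ℝ → ℝ} (hS : ∀ w, 𝓕 f w = (S w : ℂ)) (hS0 : ∀ w, 0 ≤ S w) : Integrable (𝓕 f) := by
  have hcont : Continuous (𝓕 f) :=
    VectorFourier.fourierIntegral_continuous Real.continuous_fourierChar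
      (by exact continuous_inner) hf
  have hSc : Continuous S := by
    have : S = fun w => (𝓕 f w).re := by ext w; simp [hS]
    rw [this]; fun_prop
  -- Gaussian summation of the inversion integral at `0`: the multiplication formula moves the
  -- transform from `f` onto the Gaussian, which becomes an approximate identity.
  have key : Tendsto (fun c : ℝ => ∫ w : ℝ, Real.exp (-c⁻¹ * w ^ 2) * S w) atTop
      (𝓝 (f 0).re) := by
    have h1 := Real.tendsto_integral_gaussian_smul' hf hf0
    have h2 := (Complex.continuous_re.tendsto _).comp h1
    refine h2.congr' ?_
    filter_upwards [Ioi_mem_atTop 0] with c hc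
    have hc : 0 < c := hc
    have J : Integrable (fun w : ℝ => Complex.exp (-(c⁻¹ : ℝ) * ‖w‖ ^ 2)) := by
      simpa using! GaussianFourier.integrable_cexp_neg_mul_sq_norm_add (V := ℝ)
        (b := (c⁻¹ : ℝ)) (by simpa using hc) 0 0
    have h3 := VectorFourier.integral_fourierIntegral_smul_eq_flip (L := innerₗ ℝ)
      Real.continuous_fourierChar continuous_inner J hf
    have h4 : (∫ w : ℝ, (𝓕 (fun w : ℝ => Complex.exp (-(c⁻¹ : ℝ) * ‖w‖ ^ 2)) w) • f w) =
        ∫ w : ℝ, Complex.exp (-(c⁻¹ : ℝ) * ‖w‖ ^ 2) • 𝓕 f w := by simpa using! h3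
    have h5 : ∀ w : ℝ, 𝓕 (fun w : ℝ => Complex.exp (-(c⁻¹ : ℝ) * ‖w‖ ^ 2)) w =
        ((Real.pi * c : ℂ) ^ (Module.finrank ℝ ℝ / 2 : ℂ) *
          Complex.exp (-Real.pi ^ 2 * c * ‖0 - w‖ ^ 2)) := by
      intro w
      rw [fourier_gaussian_innerProductSpace (by simpa using hc)]
      congr
      · simp
      · simp; ring
    simp only [Function.comp]
    simp only [← h5]
    rw [h4]
    have h6 : (∫ w : ℝ, Complex.exp (-(c⁻¹ : ℝ) * ‖w‖ ^ 2) • 𝓕 f w) =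
        ∫ w : ℝ, ((Real.exp (-c⁻¹ * w ^ 2) * S w : ℝ) : ℂ) := by
      congr 1; ext w
      rw [hS, smul_eq_mul]; push_cast
      congr 3
      norm_cast
      rw [Real.norm_eq_abs, sq_abs]
    rw [h6, integral_complex_ofReal, Complex.ofReal_re]
  have hint : ∀ c : ℝ, 0 < c → Integrable (fun w : ℝ => Real.exp (-c⁻¹ * w ^ 2) * S w) := by
    intro c hc
    refine (integrable_exp_neg_mul_sq (inv_pos.mpr hc)).mul_bdd (c := ∫ v, ‖f v‖)
      hSc.aestronglyMeasurable (Eventually.of_forall fun w => ?_)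
    have := VectorFourier.norm_fourierIntegral_le_integral_norm Real.fourierChar volume
      (innerₗ ℝ) f w
    have h' : ‖𝓕 f w‖ ≤ ∫ v, ‖f v‖ := this
    rwa [hS, Complex.norm_real] at h'
  refine ⟨hcont.aestronglyMeasurable, ?_⟩
  have hseq : Tendsto (fun n : ℕ => ((n : ℝ) + 1)) atTop atTop :=
    tendsto_atTop_add_const_right _ _ tendsto_natCast_atTop_atTop
  have hlim : ∀ w, Tendsto (fun n : ℕ => ENNReal.ofReal
      (Real.exp (-((n : ℝ) + 1)⁻¹ * w ^ 2) * S w)) atTop (𝓝 ‖𝓕 f w‖ₑ) := by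
    intro w
    have e1 : ‖𝓕 f w‖ₑ = ENNReal.ofReal (S w) := by
      rw [← ofReal_norm, hS, Complex.norm_real, Real.norm_of_nonneg (hS0 w)]
    rw [e1]
    refine ENNReal.tendsto_ofReal ?_
    have : Tendsto (fun n : ℕ => Real.exp (-((n : ℝ) + 1)⁻¹ * w ^ 2) * S w) atTop
        (𝓝 (Real.exp (-0 * w ^ 2) * S w)) := by
      refine Tendsto.mul_const _ ((Real.continuous_exp.tendsto _).comp ?_)
      exact ((tendsto_inv_atTop_zero.comp hseq).neg).mul_const _
    simpa using this
  rw [HasFiniteIntegral]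
  -- Fatou bounds the total mass of `S` by `f 0`; this is where `0 ≤ S` enters.
  calc ∫⁻ w, ‖𝓕 f w‖ₑ = ∫⁻ w, liminf (fun n : ℕ => ENNReal.ofReal
      (Real.exp (-((n : ℝ) + 1)⁻¹ * w ^ 2) * S w)) atTop := by
        congr 1; ext w; rw [(hlim w).liminf_eq]
    _ ≤ liminf (fun n : ℕ => ∫⁻ w, ENNReal.ofReal
      (Real.exp (-((n : ℝ) + 1)⁻¹ * w ^ 2) * S w)) atTop := by
        refine lintegral_liminf_le fun n => ?_
        have := hSc.measurable
        fun_prop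
    _ = ENNReal.ofReal (f 0).re := by
        refine Tendsto.liminf_eq ?_
        have := ENNReal.tendsto_ofReal (key.comp hseq)
        refine this.congr fun n => ?_
        simp only [Function.comp]
        rw [ofReal_integral_eq_lintegral_ofReal (hint _ (by positivity))]
        exact Eventually.of_forall fun w => mul_nonneg (Real.exp_nonneg _) (hS0 w)
    _ < ⊤ := ENNReal.ofReal_lt_top

section Curve

variable {H : Type*} [NormedAddCommGroup H] [InnerProductSpace ℂ H]
  {Z : ℝ → H} {c : ℝ → ℂ}

theorem norm_correlation_le (hc : ∀ s t, inner ℂ (Z s) (Z t) = c (t - s)) (τ : ℝ) :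
    ‖c τ‖ ≤ (c 0).re := by
  have hn : ∀ t, ‖Z t‖ ^ 2 = (c 0).re := fun t => by
    rw [@norm_sq_eq_re_inner ℂ, hc, sub_self]; rfl
  have h := norm_inner_le_norm (𝕜 := ℂ) (Z 0) (Z τ)
  rw [hc, sub_zero] at h
  have : ‖Z 0‖ = ‖Z τ‖ := by
    rw [← sq_eq_sq₀ (norm_nonneg _) (norm_nonneg _), hn, hn]
  rw [← this, ← sq, hn] at h
  exact h

theorem continuous_correlation (hZ : Continuous Z)
    (hc : ∀ s t, inner ℂ (Z s) (Z t) = c (t - s)) : Continuous c := by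
  have : c = fun τ => inner ℂ (Z 0) (Z τ) := by ext τ; rw [hc, sub_zero]
  rw [this]; fun_prop

/-- The Gaussian-damped correlation function of a stationary curve has a nonnegative Fourier
transform. -/
theorem exists_nonneg_fourier_correlation [CompleteSpace H] (hZ : Continuous Z)
    (hc : ∀ s t, inner ℂ (Z s) (Z t) = c (t - s)) {ε : ℝ} (hε : 0 < ε) (w : ℝ) :
    ∃ r : ℝ, 0 ≤ r ∧ 𝓕 (fun τ : ℝ => c τ * (Real.exp (-ε * τ ^ 2) : ℝ)) w = (r : ℂ) := by
  have hcc := continuous_correlation hZ hc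
  have hn : ∀ t, ‖Z t‖ = ‖Z 0‖ := fun t => by
    rw [← sq_eq_sq₀ (norm_nonneg _) (norm_nonneg _), @norm_sq_eq_re_inner ℂ,
      @norm_sq_eq_re_inner ℂ, hc, hc, sub_self, sub_self]
  have hcconj : ∀ τ, conj (c τ) = c (-τ) := fun τ => by
    have h1 := hc 0 τ
    have h2 := hc τ 0
    rw [sub_zero] at h1
    rw [zero_sub] at h2
    rw [← h1, ← h2, inner_conj_symm]
  -- With the rate `2ε`, `t² + (t - τ)² = 2(t - τ/2)² + τ²/2` splits the product of two such weights
  -- into a Gaussian in `t - τ/2` times exactly `exp(-ετ²)`. Hence `‖∫ φ Z‖²` is `K` times the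
  -- wanted transform, which is therefore nonnegative.
  set φ : ℝ → ℂ := fun t => (Real.exp (-(2 * ε) * t ^ 2) : ℝ) *
    Complex.exp ((-2 * Real.pi * t * w : ℝ) * Complex.I) with hφ
  have hφc : Continuous φ := by fun_prop
  have hφn : ∀ t, ‖φ t‖ = Real.exp (-(2 * ε) * t ^ 2) := fun t => by
    rw [hφ]
    simp only
    rw [norm_mul, Complex.norm_exp_ofReal_mul_I, mul_one, Complex.norm_real,
      Real.norm_of_nonneg (Real.exp_nonneg _)]
  have hφi : Integrable φ :=
    (integrable_exp_neg_mul_sq (b := 2 * ε) (by positivity)).mono' hφc.aestronglyMeasurable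
      (Eventually.of_forall fun t => (hφn t).le)
  have hφZ : Integrable (fun t => φ t • Z t) :=
    hφi.smul_bdd (C := ‖Z 0‖) hZ.aestronglyMeasurable (Eventually.of_forall fun t => (hn t).le)
  set V := ∫ t, φ t • Z t with hV
  set K := ∫ u : ℝ, Real.exp (-(4 * ε) * u ^ 2) with hK
  have hKpos : 0 < K := by
    rw [hK, integral_gaussian]; positivity
  have h1 : ∀ t, inner ℂ V (Z t) = ∫ τ, conj (φ (t - τ)) * c τ := by
    intro t
    rw [← inner_conj_symm, hV, ← integral_inner hφZ, ← integral_conj,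
      ← integral_sub_left_eq_self _ _ t]
    congr 1; ext τ
    rw [inner_smul_right, hc, map_mul, hcconj]
    congr 2; ring
  have hprod : ∀ t τ, φ t * (conj (φ (t - τ)) * c τ) =
      (Real.exp (-(4 * ε) * (t - τ / 2) ^ 2) : ℝ) *
      (Complex.exp ((-2 * Real.pi * τ * w : ℝ) * Complex.I) *
        (c τ * (Real.exp (-ε * τ ^ 2) : ℝ))) := by
    intro t τ
    have e1 : φ t * conj (φ (t - τ)) = (Real.exp (-(4 * ε) * (t - τ / 2) ^ 2) : ℝ) *
      (Complex.exp ((-2 * Real.pi * τ * w : ℝ) * Complex.I) * (Real.exp (-ε * τ ^ 2) : ℝ)) := by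
      simp only [hφ, map_mul, Complex.conj_ofReal, ← Complex.exp_conj, Complex.conj_I]
      simp only [Complex.ofReal_exp, ← Complex.exp_add]
      congr 1
      push_cast; ring
    rw [← mul_assoc, e1]; ring
  have hFi : Integrable (fun q : ℝ × ℝ => φ q.1 * (conj (φ (q.1 - q.2)) * c q.2))
      (volume.prod volume) := by
    rw [integrable_prod_iff' (by
      refine Continuous.aestronglyMeasurable ?_
      fun_prop)]
    have hg : ∀ τ : ℝ, Integrable fun t => Real.exp (-(4 * ε) * (t - τ / 2) ^ 2) := fun τ =>
      (integrable_exp_neg_mul_sq (b := 4 * ε) (by positivity)).comp_sub_right (τ / 2)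
    simp only [hprod]
    refine ⟨Eventually.of_forall fun τ => ((hg τ).ofReal).mul_const _, ?_⟩
    have : (fun τ : ℝ => ∫ t : ℝ, ‖((Real.exp (-(4 * ε) * (t - τ / 2) ^ 2) : ℝ) : ℂ) *
      (Complex.exp ((-2 * Real.pi * τ * w : ℝ) * Complex.I) *
        (c τ * (Real.exp (-ε * τ ^ 2) : ℝ)))‖) = fun τ => K * ‖c τ * (Real.exp (-ε * τ ^ 2) : ℝ)‖ := by
      ext τ
      simp only [norm_mul, Complex.norm_exp_ofReal_mul_I, one_mul, Complex.norm_real,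
        Real.norm_of_nonneg (Real.exp_nonneg _)]
      rw [integral_mul_const, integral_sub_right_eq_self (fun t => Real.exp (-(4 * ε) * t ^ 2))]
    rw [this]
    refine Integrable.const_mul (Integrable.norm ?_) _
    refine Integrable.bdd_mul (c := (c 0).re) ?_ hcc.aestronglyMeasurable
      (Eventually.of_forall (norm_correlation_le hc))
    exact (integrable_exp_neg_mul_sq hε).ofReal
  have h2 : inner ℂ V V = (K : ℂ) * 𝓕 (fun τ : ℝ => c τ * (Real.exp (-ε * τ ^ 2) : ℝ)) w := by
    conv_lhs => rw [hV]
    rw [← hV, ← integral_inner hφZ]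
    simp only [inner_smul_right, h1, ← integral_const_mul]
    rw [integral_integral_swap hFi]
    simp only [hprod]
    rw [Real.fourier_real_eq_integral_exp_smul, ← integral_const_mul]
    congr 1; ext τ
    rw [integral_mul_const, integral_complex_ofReal,
      integral_sub_right_eq_self (fun t => Real.exp (-(4 * ε) * t ^ 2))]
    rfl
  refine ⟨K⁻¹ * ‖V‖ ^ 2, by positivity, ?_⟩
  have hK0 : (K : ℂ) ≠ 0 := by exact_mod_cast hKpos.ne'
  rw [inner_self_eq_norm_sq_to_K] at h2
  rw [← mul_right_inj' hK0, ← h2]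
  push_cast
  field_simp
  simp

/-- The Gaussian-damped correlation function is a characteristic function. -/
theorem exists_charFun_eq_damped_correlation [CompleteSpace H] (hZ : Continuous Z)
    (hc : ∀ s t, inner ℂ (Z s) (Z t) = c (t - s)) {ε : ℝ} (hε : 0 < ε) :
    ∃ ρ : Measure ℝ, IsFiniteMeasure ρ ∧
      ∀ τ, charFun ρ τ = c τ * (Real.exp (-ε * τ ^ 2) : ℝ) := by
  have hcc := continuous_correlation hZ hc
  choose S hS0 hS using exists_nonneg_fourier_correlation hZ hc hε
  set f : ℝ → ℂ := fun τ : ℝ => c τ * (Real.exp (-ε * τ ^ 2) : ℝ) with hfdef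
  have hfc : Continuous f := by fun_prop
  have hf : Integrable f := Integrable.bdd_mul (c := (c 0).re)
    (integrable_exp_neg_mul_sq hε).ofReal hcc.aestronglyMeasurable
      (Eventually.of_forall (norm_correlation_le hc))
  have hFi := integrable_fourier_of_nonneg hf hfc.continuousAt hS hS0
  have hSi : Integrable S := by
    have := hFi.re
    simpa [hS] using this
  have hfin : IsFiniteMeasure (volume.withDensity fun w => ENNReal.ofReal (S w)) :=
    isFiniteMeasure_withDensity_ofReal hSi.2
  -- The dilation by `2π` passes from the phase `e^{2πiwτ}` of `𝓕` to the phase `e^{iωτ}` of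
  -- `charFun`.
  refine ⟨(volume.withDensity fun w => ENNReal.ofReal (S w)).map (fun w => 2 * Real.pi * w),
    inferInstance, fun τ => ?_⟩
  rw [charFun_apply_real, integral_map (by fun_prop) (by
    refine Continuous.aestronglyMeasurable ?_; fun_prop),
    integral_withDensity_eq_integral_toReal_smul₀ (by
      exact hSi.aemeasurable.ennreal_ofReal) (by simp)]
  have h3 := congrFun (hfc.fourierInv_fourier_eq hf hFi) τ
  change _ = f τ
  rw [← h3, Real.fourierInv_eq']
  congr 1; ext w
  rw [hS, ENNReal.toReal_ofReal (hS0 w), Complex.real_smul, smul_eq_mul, mul_comm]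
  congr 2
  simp
  ring

/-- **Bochner's theorem** for stationary curves (Khinchin): the correlation function of a continuous
stationary curve in a Hilbert space is the characteristic function of its spectral measure. -/
theorem exists_charFun_eq_correlation [CompleteSpace H] (hZ : Continuous Z)
    (hc : ∀ s t, inner ℂ (Z s) (Z t) = c (t - s)) :
    ∃ ρ : Measure ℝ, IsFiniteMeasure ρ ∧ ∀ τ, charFun ρ τ = c τ := by
  have hcc := continuous_correlation hZ hc
  have hbd := norm_correlation_le hc
  have hc0 : c 0 = ((c 0).re : ℂ) := by
    have := hc 0 0
    rw [sub_self, inner_self_eq_norm_sq_to_K] at this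
    rw [← this]; norm_cast
  rcases eq_or_ne (c 0).re 0 with h0 | h0
  · refine ⟨0, inferInstance, fun τ => ?_⟩
    have := hbd τ
    rw [h0] at this
    rw [charFun_zero_measure]
    exact (norm_le_zero_iff.mp this).symm
  have hpos : 0 < (c 0).re := lt_of_le_of_ne ((norm_nonneg _).trans (hbd 0)) h0.symm
  choose ρ hρf hρ using fun n : ℕ =>
    exists_charFun_eq_damped_correlation hZ hc (ε := ((n : ℝ) + 1)⁻¹) (by positivity)
  set q : ENNReal := ENNReal.ofReal (c 0).re⁻¹ with hq
  have hmass : ∀ n, ρ n univ = ENNReal.ofReal (c 0).re := fun n => by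
    have h := hρ n 0
    rw [charFun_zero] at h
    rw [← ofReal_measureReal]
    congr 1
    rw [hc0] at h
    simp only [ne_eq, OfNat.ofNat_ne_zero, not_false_eq_true, zero_pow, mul_zero, Real.exp_zero,
      Complex.ofReal_one, mul_one] at h
    exact_mod_cast h
  have hprob : ∀ n, IsProbabilityMeasure (q • ρ n) := fun n => ⟨by
    rw [Measure.smul_apply, hmass, smul_eq_mul, hq, ← ENNReal.ofReal_mul (by positivity),
      inv_mul_cancel₀ h0, ENNReal.ofReal_one]⟩
  have hchar : ∀ n τ, charFun (q • ρ n) τ =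
      ((c 0).re⁻¹ : ℝ) * (c τ * (Real.exp (-((n : ℝ) + 1)⁻¹ * τ ^ 2) : ℝ)) := fun n τ => by
    rw [charFun_apply, integral_smul_measure, ← charFun_apply, hρ, hq,
      ENNReal.toReal_ofReal (by positivity), Complex.real_smul]
  have hlim : ∀ τ, Tendsto (fun n => charFun (q • ρ n) τ) atTop
      (𝓝 (((c 0).re⁻¹ : ℝ) * c τ)) := fun τ => by
    simp only [hchar]
    refine Tendsto.const_mul _ ?_
    have hseq : Tendsto (fun n : ℕ => ((n : ℝ) + 1)) atTop atTop :=
      tendsto_atTop_add_const_right _ _ tendsto_natCast_atTop_atTop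
    have h1 : Tendsto (fun n : ℕ => Real.exp (-((n : ℝ) + 1)⁻¹ * τ ^ 2)) atTop
        (𝓝 (Real.exp (-0 * τ ^ 2))) :=
      (Real.continuous_exp.tendsto _).comp
        (((tendsto_inv_atTop_zero.comp hseq).neg).mul_const _)
    rw [neg_zero, zero_mul, Real.exp_zero] at h1
    have h2 := ((Complex.continuous_ofReal.tendsto _).comp h1).const_mul (c τ)
    simpa using h2
  -- The damping rate `1/(n+1)` tends to zero, so the characteristic functions converge to a
  -- continuous function; by Lévy's criterion no mass escapes.
  have htight := isTightMeasureSet_of_tendsto_charFun (μ := fun n => q • ρ n)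
    (f := fun τ => ((c 0).re⁻¹ : ℝ) * c τ) (by fun_prop) hlim
  set P : ℕ → ProbabilityMeasure ℝ := fun n => ⟨q • ρ n, hprob n⟩ with hP
  have hcompact : IsCompact (closure (range P)) := by
    refine isCompact_closure_of_isTightMeasureSet ?_
    convert htight using 1
    ext ν
    constructor
    · rintro ⟨_, ⟨n, rfl⟩, rfl⟩
      exact ⟨n, rfl⟩
    · rintro ⟨n, rfl⟩
      exact ⟨P n, ⟨n, rfl⟩, rfl⟩
  -- A limit along a nonprincipal ultrafilter replaces the extraction of a subsequence; it still
  -- sees the pointwise limit of the characteristic functions.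
  obtain ⟨ν, -, hν⟩ := hcompact.ultrafilter_le_nhds ((Filter.hyperfilter ℕ).map P) (by
    rw [Ultrafilter.coe_map, le_principal_iff, mem_map]
    exact Eventually.of_forall fun n => subset_closure (mem_range_self n))
  have hν' : Tendsto P (Filter.hyperfilter ℕ) (𝓝 ν) := hν
  have hcf : ∀ τ, charFun (ν : Measure ℝ) τ = ((c 0).re⁻¹ : ℝ) * c τ := fun τ => by
    rw [ProbabilityMeasure.tendsto_iff_forall_integral_rclike_tendsto ℂ] at hν'
    have h1 := hν' (BoundedContinuousFunction.innerProbChar τ)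
    simp only [← charFun_eq_integral_innerProbChar] at h1
    have hle : (Filter.hyperfilter ℕ : Filter ℕ) ≤ atTop := by
      rw [← Nat.cofinite_eq_atTop]; exact Filter.hyperfilter_le_cofinite
    exact tendsto_nhds_unique h1 ((hlim τ).mono_left hle)
  refine ⟨(c 0).re.toNNReal • (ν : Measure ℝ), inferInstance, fun τ => ?_⟩
  have : charFun ((c 0).re.toNNReal • (ν : Measure ℝ)) τ = (c 0).re * charFun (ν : Measure ℝ) τ := by
    rw [charFun_apply, integral_smul_nnreal_measure, ← charFun_apply, NNReal.smul_def,
      Real.coe_toNNReal _ hpos.le, Complex.real_smul]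
  rw [this, hcf, ← mul_assoc, ← Complex.ofReal_mul, mul_inv_cancel₀ h0, Complex.ofReal_one, one_mul]

end Curve

/-! ### The Gaussian test function and Fourier transforms of test functions. -/

theorem exists_bound_pow_mul_polynomial_mul_gaussian (k : ℕ) (q : Polynomial ℤ) :
    ∃ C, ∀ x : ℝ, |x| ^ k * (|Polynomial.aeval x q| * Real.exp (-(x ^ 2 / 2))) ≤ C := by
  induction q using Polynomial.induction_on' with
  | add q₁ q₂ h₁ h₂ =>
    obtain ⟨C₁, h₁⟩ := h₁
    obtain ⟨C₂, h₂⟩ := h₂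
    refine ⟨C₁ + C₂, fun x => le_trans ?_ (add_le_add (h₁ x) (h₂ x))⟩
    rw [← mul_add, ← add_mul, map_add]
    gcongr
    exact abs_add_le _ _
  | monomial n a =>
    set j := k + n with hj
    refine ⟨|(a : ℝ)| * (1 + j.factorial * 2 ^ j), fun x => ?_⟩
    have h1 := Real.pow_div_factorial_le_exp (x ^ 2 / 2) (by positivity) j
    -- Passing to an even power allows comparison with one term of the exponential series in `x²/2`.
    have h2 : |x| ^ j ≤ 1 + (x ^ 2) ^ j := by
      rw [← sq_abs x, ← pow_mul, mul_comm 2 j, pow_mul]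
      nlinarith [sq_nonneg (|x| ^ j - 1), sq_nonneg (|x| ^ j)]
    have h3 : (x ^ 2) ^ j ≤ j.factorial * 2 ^ j * Real.exp (x ^ 2 / 2) := by
      rw [div_pow, div_div, div_le_iff₀ (by positivity)] at h1
      linarith
    have h4 : |x| ^ j * Real.exp (-(x ^ 2 / 2)) ≤ 1 + j.factorial * 2 ^ j := by
      have h5 : Real.exp (x ^ 2 / 2) * Real.exp (-(x ^ 2 / 2)) = 1 := by
        rw [← Real.exp_add, add_neg_cancel, Real.exp_zero]
      have h6 : Real.exp (-(x ^ 2 / 2)) ≤ 1 := Real.exp_le_one_iff.mpr (by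
        have := sq_nonneg x; linarith)
      calc |x| ^ j * Real.exp (-(x ^ 2 / 2))
          ≤ (1 + j.factorial * 2 ^ j * Real.exp (x ^ 2 / 2)) * Real.exp (-(x ^ 2 / 2)) := by
            gcongr; linarith
        _ = Real.exp (-(x ^ 2 / 2)) +
            j.factorial * 2 ^ j * (Real.exp (x ^ 2 / 2) * Real.exp (-(x ^ 2 / 2))) := by ring
        _ ≤ _ := by rw [h5, mul_one]; gcongr
    calc |x| ^ k * (|Polynomial.aeval x (Polynomial.monomial n a)| * Real.exp (-(x ^ 2 / 2)))
        = |(a : ℝ)| * (|x| ^ j * Real.exp (-(x ^ 2 / 2))) := by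
          rw [Polynomial.aeval_monomial, abs_mul, abs_pow, hj, pow_add]
          simp only [algebraMap_int_eq, eq_intCast]
          ring
      _ ≤ _ := by gcongr

/-- The Gaussian `exp (-t² / 2)` as a Schwartz function. -/
def gaussian : 𝓢(ℝ, ℝ) where
  toFun t := Real.exp (-(t ^ 2 / 2))
  smooth' := by fun_prop
  decay' k n := by
    obtain ⟨C, hC⟩ := exists_bound_pow_mul_polynomial_mul_gaussian k (Polynomial.hermite n)
    refine ⟨C, fun x => ?_⟩
    rw [norm_iteratedFDeriv_eq_norm_iteratedDeriv, iteratedDeriv_eq_iterate,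
      Polynomial.deriv_gaussian_eq_hermite_mul_gaussian]
    simpa [abs_mul] using hC x

/-- The Fourier transform `∫ e^{iωt} φ(t) dt`. -/
def posFT (φ : ℝ → ℝ) (ω : ℝ) : ℂ := ∫ t : ℝ, Complex.exp (ω * t * Complex.I) * φ t

theorem norm_exp_mul_mul_I (ω t : ℝ) : ‖Complex.exp (ω * t * Complex.I)‖ = 1 := by
  rw [← Complex.ofReal_mul, Complex.norm_exp_ofReal_mul_I]

theorem integrable_exp_mul {φ : ℝ → ℝ} (hφ : Integrable φ) (ω : ℝ) :
    Integrable fun t : ℝ => Complex.exp (ω * t * Complex.I) * φ t :=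
  hφ.ofReal.bdd_mul (c := 1) (Continuous.aestronglyMeasurable (by fun_prop))
    (Eventually.of_forall fun t => (norm_exp_mul_mul_I ω t).le)

theorem norm_posFT_le (φ : ℝ → ℝ) (ω : ℝ) : ‖posFT φ ω‖ ≤ ∫ t, ‖φ t‖ := by
  refine (norm_integral_le_integral_norm _).trans_eq ?_
  congr 1; ext t
  rw [norm_mul, norm_exp_mul_mul_I, one_mul, Complex.norm_real]

theorem continuous_posFT {φ : ℝ → ℝ} (hφ : Integrable φ) : Continuous (posFT φ) := by
  refine continuous_of_dominated (bound := fun t => ‖φ t‖) (fun ω => ?_) (fun ω => ?_) hφ.norm ?_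
  · exact (integrable_exp_mul hφ ω).aestronglyMeasurable
  · refine Eventually.of_forall fun t => ?_
    rw [norm_mul, norm_exp_mul_mul_I, one_mul, Complex.norm_real]
  · exact Eventually.of_forall fun t => by fun_prop

theorem posFT_comp_sub (φ : ℝ → ℝ) (a ω : ℝ) :
    posFT (fun t => φ (t - a)) ω = Complex.exp (ω * a * Complex.I) * posFT φ ω := by
  rw [posFT, posFT, ← integral_const_mul,
    ← integral_sub_right_eq_self (fun t : ℝ => Complex.exp (ω * a * Complex.I) *
      (Complex.exp (ω * t * Complex.I) * φ t)) a]
  congr 1; ext t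
  rw [← mul_assoc, ← Complex.exp_add]
  congr 2
  push_cast; ring

theorem posFT_deriv (g : 𝓢(ℝ, ℝ)) (ω : ℝ) :
    posFT (deriv fun u => g u) ω = -(Complex.I * ω) * posFT g ω := by
  have hg' : Integrable (deriv fun u => g u) := (SchwartzMap.derivCLM ℝ ℝ g).integrable
  have hu : ∀ t : ℝ, HasDerivAt (fun t : ℝ => Complex.exp (ω * t * Complex.I))
      ((Complex.I * ω) * Complex.exp (ω * t * Complex.I)) t := fun t => by
    have h1 : HasDerivAt (fun t : ℝ => (ω * t * Complex.I : ℂ)) (ω * 1 * Complex.I) t :=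
      ((Complex.ofRealCLM.hasDerivAt (x := t)).const_mul (ω : ℂ)).mul_const Complex.I
    convert h1.cexp using 1
    ring
  have hv : ∀ t : ℝ, HasDerivAt (fun t : ℝ => (g t : ℂ)) ((deriv (fun u => g u) t : ℝ) : ℂ) t :=
    fun t => (g.differentiableAt.hasDerivAt).ofReal_comp
  have h := integral_mul_deriv_eq_deriv_mul_of_integrable (u := fun t : ℝ =>
    Complex.exp (ω * t * Complex.I)) (v := fun t : ℝ => (g t : ℂ))
    (u' := fun t : ℝ => (Complex.I * ω) * Complex.exp (ω * t * Complex.I))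
    (v' := fun t : ℝ => ((deriv (fun u => g u) t : ℝ) : ℂ))
    (fun t _ => hu t) (fun t _ => hv t)
    (integrable_exp_mul hg' ω)
    (by
      have := (integrable_exp_mul g.integrable ω).const_mul (Complex.I * ω)
      refine this.congr (Eventually.of_forall fun t => ?_)
      simp [mul_assoc])
    (integrable_exp_mul g.integrable ω)
  rw [posFT, posFT, h, neg_mul, ← integral_const_mul]
  simp only [mul_assoc]

theorem iteratedDeriv_two_schwartz (g : 𝓢(ℝ, ℝ)) :
    iteratedDeriv 2 (fun u => g u) = deriv fun u => SchwartzMap.derivCLM ℝ ℝ g u := by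
  rw [iteratedDeriv_succ, iteratedDeriv_one]
  rfl

theorem integrable_deriv_schwartz (g : 𝓢(ℝ, ℝ)) : Integrable (deriv fun u => g u) :=
  (SchwartzMap.derivCLM ℝ ℝ g).integrable

theorem integrable_iteratedDeriv_two_schwartz (g : 𝓢(ℝ, ℝ)) :
    Integrable (iteratedDeriv 2 fun u => g u) := by
  rw [iteratedDeriv_two_schwartz]
  exact integrable_deriv_schwartz _

theorem posFT_iteratedDeriv_two (g : 𝓢(ℝ, ℝ)) (ω : ℝ) :
    posFT (iteratedDeriv 2 fun u => g u) ω = -(ω : ℂ) ^ 2 * posFT g ω := by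
  rw [iteratedDeriv_two_schwartz, posFT_deriv]
  have : posFT (SchwartzMap.derivCLM ℝ ℝ g) ω = posFT (deriv fun u => g u) ω := rfl
  rw [this, posFT_deriv, ← mul_assoc]
  congr 1
  linear_combination (ω : ℂ) ^ 2 * Complex.I_sq

theorem posFT_gaussian (ω : ℝ) :
    posFT gaussian ω = (Real.sqrt (2 * Real.pi) * Real.exp (-(ω ^ 2 / 2)) : ℝ) := by
  have h := fourierIntegral_gaussian (b := (1 / 2 : ℂ)) (by norm_num) ω
  rw [posFT]
  convert h using 1
  · congr 1; ext t
    congr 1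
    · congr 1; ring
    · change ((Real.exp (-(t ^ 2 / 2)) : ℝ) : ℂ) = _
      push_cast
      congr 1; ring
  · push_cast
    congr 1
    · rw [Real.sqrt_eq_rpow, Complex.ofReal_cpow (by positivity)]
      push_cast
      congr 1; ring
    · congr 1; ring

/-! ### The symbol of the Langevin operator. -/

section Symbol

variable (p : Params) (μ : FrictionKernel)

theorem norm_exp_neg_I_mul (ω s : ℝ) : ‖Complex.exp (-(Complex.I * ω * s))‖ = 1 := by
  have : -(Complex.I * ω * s) = ((-(ω * s) : ℝ) : ℂ) * Complex.I := by push_cast; ring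
  rw [this, Complex.norm_exp_ofReal_mul_I]

theorem continuous_ft : Continuous μ.ft := by
  refine continuous_const.add ?_
  refine continuous_of_dominated (bound := fun s => ‖μ.mem s‖) (fun ω => ?_) (fun ω => ?_)
    μ.integrable_mem.norm ?_
  · exact μ.integrable_mem.ofReal.aestronglyMeasurable.mul
      (Continuous.aestronglyMeasurable (by fun_prop))
  · refine Eventually.of_forall fun s => ?_
    rw [norm_mul, norm_exp_neg_I_mul, mul_one, Complex.norm_real]
  · exact Eventually.of_forall fun t => by fun_prop

theorem norm_ft_le (ω : ℝ) : ‖μ.ft ω‖ ≤ |μ.inst| + ∫ s in Ioi (0 : ℝ), ‖μ.mem s‖ := by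
  refine (norm_add_le _ _).trans (add_le_add (by simp) ?_)
  refine (norm_integral_le_integral_norm _).trans_eq ?_
  congr 1; ext s
  rw [norm_mul, norm_exp_neg_I_mul, mul_one, Complex.norm_real]

theorem ft_neg (ω : ℝ) : μ.ft (-ω) = conj (μ.ft ω) := by
  rw [FrictionKernel.ft, FrictionKernel.ft, map_add, Complex.conj_ofReal, ← integral_conj]
  congr 2; ext s
  rw [map_mul, Complex.conj_ofReal, ← Complex.exp_conj]
  congr 2
  simp

/-- The symbol of the quantum Langevin equation acting on the circular component `x + iσy`,
`σ = ±1`. -/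
def langevinSymbol (σ ω : ℝ) : ℂ :=
  p.m * (p.ω₀ ^ 2 - ω ^ 2) + Complex.I * ω * μ.ft ω - σ * (p.e / p.c * p.B) * ω

theorem continuous_langevinSymbol (σ : ℝ) : Continuous (langevinSymbol p μ σ) := by
  have := continuous_ft μ
  unfold langevinSymbol
  fun_prop

end Symbol

/-! ### Functions of time given by a spectral density. -/

section Spectral

variable {ρ : Measure ℝ} [IsFiniteMeasure ρ] {b : ℝ → ℂ}

/-- The function of time with spectral density `b` with respect to `ρ`. -/
def spectralFun (ρ : Measure ℝ) (b : ℝ → ℂ) (s : ℝ) : ℂ :=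
  ∫ ω : ℝ, Complex.exp (ω * s * Complex.I) * b ω ∂ρ

omit [IsFiniteMeasure ρ] in
theorem integrable_exp_mul_density (hb : Integrable b ρ) (s : ℝ) :
    Integrable (fun ω : ℝ => Complex.exp (ω * s * Complex.I) * b ω) ρ :=
  hb.bdd_mul (c := 1) (Continuous.aestronglyMeasurable (by fun_prop))
    (Eventually.of_forall fun t => (norm_exp_mul_mul_I t s).le)

theorem integral_spectralFun_mul (hb : Integrable b ρ) {φ : ℝ → ℝ} (hφ : Integrable φ) :
    ∫ s, spectralFun ρ b s * φ s = ∫ ω, b ω * posFT φ ω ∂ρ := by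
  simp only [spectralFun, posFT, ← integral_mul_const, ← integral_const_mul]
  rw [integral_integral_swap]
  · congr 1; ext ω; congr 1; ext s; ring
  · have h1 : Integrable (fun q : ℝ × ℝ => (φ q.1 : ℂ) * b q.2) (volume.prod ρ) :=
      hφ.ofReal.mul_prod hb
    have h2 := h1.bdd_mul (c := 1) (f := fun q : ℝ × ℝ => Complex.exp (q.2 * q.1 * Complex.I))
      (Continuous.aestronglyMeasurable (by fun_prop))
      (Eventually.of_forall fun q => (norm_exp_mul_mul_I q.2 q.1).le)
    refine h2.congr (Eventually.of_forall fun q => ?_)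
    simp only [Function.uncurry]
    ring

/-- Since `e^{iω(t-s)} = e^{iωt} e^{-iωs}`, Fubini turns the causal memory integral into
multiplication by `μ.ft`. -/
theorem friction_spectralFun (μ : FrictionKernel) (hb : Integrable b ρ) (t : ℝ) :
    (μ.inst : ℂ) * spectralFun ρ b t + ∫ s in Ioi (0 : ℝ), (μ.mem s : ℂ) * spectralFun ρ b (t - s)
      = spectralFun ρ (fun ω => b ω * μ.ft ω) t := by
  have h1 : ∫ s in Ioi (0 : ℝ), (μ.mem s : ℂ) * spectralFun ρ b (t - s) =
      ∫ ω : ℝ, Complex.exp (ω * t * Complex.I) * b ω *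
        (∫ s in Ioi (0 : ℝ), (μ.mem s : ℂ) * Complex.exp (-(Complex.I * ω * s))) ∂ρ := by
    simp only [spectralFun, ← integral_const_mul]
    rw [integral_integral_swap]
    · congr 1; ext ω; congr 1; ext s
      have : Complex.exp (ω * (t - s : ℝ) * Complex.I) =
          Complex.exp (ω * t * Complex.I) * Complex.exp (-(Complex.I * ω * s)) := by
        rw [← Complex.exp_add]; congr 1; push_cast; ring
      rw [this]; ring
    · have h1 : Integrable (fun q : ℝ × ℝ => (μ.mem q.1 : ℂ) * b q.2)
          ((volume.restrict (Ioi 0)).prod ρ) := μ.integrable_mem.ofReal.mul_prod hb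
      have h2 := h1.bdd_mul (c := 1)
        (f := fun q : ℝ × ℝ => Complex.exp (q.2 * (t - q.1 : ℝ) * Complex.I))
        (Continuous.aestronglyMeasurable (by fun_prop))
        (Eventually.of_forall fun q => (norm_exp_mul_mul_I q.2 _).le)
      refine h2.congr (Eventually.of_forall fun q => ?_)
      simp only [Function.uncurry]
      ring
  have hft : Integrable (fun ω => b ω * μ.ft ω) ρ :=
    hb.mul_bdd (continuous_ft μ).aestronglyMeasurable (Eventually.of_forall (norm_ft_le μ))
  have h2 : Integrable (fun ω : ℝ => Complex.exp (ω * t * Complex.I) * b ω *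
        ∫ s in Ioi (0 : ℝ), (μ.mem s : ℂ) * Complex.exp (-(Complex.I * ω * s))) ρ := by
    have h3 := (integrable_exp_mul_density hft t).sub
      ((integrable_exp_mul_density hb t).const_mul (μ.inst : ℂ))
    refine h3.congr (Eventually.of_forall fun ω => ?_)
    simp only [Pi.sub_apply, FrictionKernel.ft]
    ring
  rw [h1, spectralFun, spectralFun, ← integral_const_mul,
    ← integral_add ((integrable_exp_mul_density hb t).const_mul _) h2]
  congr 1; ext ω
  rw [FrictionKernel.ft]
  ring

omit [IsFiniteMeasure ρ] in
theorem integrable_density_mul_posFT (hb : Integrable b ρ) {φ : ℝ → ℝ} (hφ : Integrable φ) :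
    Integrable (fun ω => b ω * posFT φ ω) ρ :=
  hb.mul_bdd (continuous_posFT hφ).aestronglyMeasurable (Eventually.of_forall (norm_posFT_le φ))

/-- The Langevin operator, tested against `g`, acts on the circular components by multiplication of
spectral densities by its symbol. -/
theorem langevin_spectralFun (p : Params) (μ : FrictionKernel) (σ : ℝ) (hb : Integrable b ρ)
    (g : 𝓢(ℝ, ℝ)) :
    (∫ t, (p.m : ℂ) * spectralFun ρ b t * ((iteratedDeriv 2 (fun u => g u) t : ℝ) : ℂ))
      - (∫ t, ((μ.inst : ℂ) * spectralFun ρ b t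
            + ∫ s in Ioi (0 : ℝ), (μ.mem s : ℂ) * spectralFun ρ b (t - s))
              * ((deriv (fun u => g u) t : ℝ) : ℂ))
      + (∫ t, (p.m * p.ω₀ ^ 2 : ℂ) * spectralFun ρ b t * ((g t : ℝ) : ℂ))
      + (∫ t, (p.e / p.c : ℂ) * (-(Complex.I * σ) * p.B * spectralFun ρ b t)
            * ((deriv (fun u => g u) t : ℝ) : ℂ))
      = ∫ ω, b ω * (langevinSymbol p μ σ ω * posFT g ω) ∂ρ := by
  have hft : Integrable (fun ω => b ω * μ.ft ω) ρ :=
    hb.mul_bdd (continuous_ft μ).aestronglyMeasurable (Eventually.of_forall (norm_ft_le μ))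
  have i1 := (integrable_density_mul_posFT hb (integrable_iteratedDeriv_two_schwartz g)).const_mul
    (p.m : ℂ)
  have i2 := integrable_density_mul_posFT hft (integrable_deriv_schwartz g)
  have i3 := (integrable_density_mul_posFT hb g.integrable).const_mul (p.m * p.ω₀ ^ 2 : ℂ)
  have i4 := (integrable_density_mul_posFT hb (integrable_deriv_schwartz g)).const_mul
    ((p.e / p.c : ℂ) * (-(Complex.I * σ) * p.B))
  have i12 : Integrable (fun ω => (p.m : ℂ) * (b ω * posFT (iteratedDeriv 2 fun u => g u) ω)
      - b ω * μ.ft ω * posFT (deriv fun u => g u) ω) ρ := i1.sub i2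
  have i123 : Integrable (fun ω => (p.m : ℂ) * (b ω * posFT (iteratedDeriv 2 fun u => g u) ω)
      - b ω * μ.ft ω * posFT (deriv fun u => g u) ω
      + (p.m * p.ω₀ ^ 2 : ℂ) * (b ω * posFT g ω)) ρ := i12.add i3
  have e1 : ∫ t, (p.m : ℂ) * spectralFun ρ b t * ((iteratedDeriv 2 (fun u => g u) t : ℝ) : ℂ) =
      ∫ ω, (p.m : ℂ) * (b ω * posFT (iteratedDeriv 2 fun u => g u) ω) ∂ρ := by
    rw [integral_const_mul, ← integral_spectralFun_mul hb (integrable_iteratedDeriv_two_schwartz g),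
      ← integral_const_mul]
    simp only [mul_assoc]
  have e3 : ∫ t, (p.m * p.ω₀ ^ 2 : ℂ) * spectralFun ρ b t * ((g t : ℝ) : ℂ) =
      ∫ ω, (p.m * p.ω₀ ^ 2 : ℂ) * (b ω * posFT g ω) ∂ρ := by
    rw [integral_const_mul, ← integral_spectralFun_mul hb g.integrable, ← integral_const_mul]
    simp only [mul_assoc]
  have e4 : ∫ t, (p.e / p.c : ℂ) * (-(Complex.I * σ) * p.B * spectralFun ρ b t)
            * ((deriv (fun u => g u) t : ℝ) : ℂ) =
      ∫ ω, (p.e / p.c : ℂ) * (-(Complex.I * σ) * p.B) *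
        (b ω * posFT (deriv fun u => g u) ω) ∂ρ := by
    rw [integral_const_mul, ← integral_spectralFun_mul hb (integrable_deriv_schwartz g),
      ← integral_const_mul]
    simp only [mul_assoc]
  simp only [friction_spectralFun μ hb]
  rw [e1, e3, e4, integral_spectralFun_mul hft (integrable_deriv_schwartz g),
    ← integral_sub i1 i2, ← integral_add i12 i3, ← integral_add i123 i4]
  congr 1; ext ω
  simp only [posFT_deriv, posFT_iteratedDeriv_two, langevinSymbol]
  linear_combination (p.e / p.c * σ * p.B * ω * b ω * posFT g ω : ℂ) * Complex.I_sq

/-- Each power of `ω` in the symbol is absorbed by a derivative of `g`, whose transform is bounded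
by its `L¹` norm. Boundedness is what is needed against `ρ`, which is known only to be finite and
may lack moments. -/
theorem exists_bound_langevinSymbol_mul_posFT (p : Params) (μ : FrictionKernel) (σ : ℝ)
    (g : 𝓢(ℝ, ℝ)) : ∃ C, ∀ ω, ‖langevinSymbol p μ σ ω * posFT g ω‖ ≤ C := by
  refine ⟨|p.m * p.ω₀ ^ 2| * (∫ t, ‖g t‖) + |p.m| * (∫ t, ‖iteratedDeriv 2 (fun u => g u) t‖)
    + (|μ.inst| + ∫ s in Ioi (0 : ℝ), ‖μ.mem s‖) * (∫ t, ‖deriv (fun u => g u) t‖)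
    + |σ * (p.e / p.c * p.B)| * (∫ t, ‖deriv (fun u => g u) t‖), fun ω => ?_⟩
  have e : langevinSymbol p μ σ ω * posFT g ω =
      ((p.m * p.ω₀ ^ 2 : ℝ) : ℂ) * posFT g ω
      + (p.m : ℂ) * posFT (iteratedDeriv 2 fun u => g u) ω
      + μ.ft ω * (-posFT (deriv fun u => g u) ω)
      + ((σ * (p.e / p.c * p.B) : ℝ) : ℂ) * (-Complex.I * posFT (deriv fun u => g u) ω) := by
    simp only [posFT_deriv, posFT_iteratedDeriv_two, langevinSymbol]
    push_cast
    linear_combination (-(σ * (p.e / p.c * p.B) * ω * posFT g ω : ℂ)) * Complex.I_sq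
  rw [e]
  refine (norm_add_le _ _).trans (add_le_add ((norm_add_le _ _).trans (add_le_add
    ((norm_add_le _ _).trans (add_le_add ?_ ?_)) ?_)) ?_)
  · rw [norm_mul, Complex.norm_real, Real.norm_eq_abs]
    gcongr; exact norm_posFT_le _ _
  · rw [norm_mul, Complex.norm_real, Real.norm_eq_abs]
    gcongr; exact norm_posFT_le _ _
  · rw [norm_mul, norm_neg]
    gcongr
    · exact norm_ft_le μ ω
    · exact norm_posFT_le _ _
  · rw [norm_mul, norm_mul, norm_neg, Complex.norm_I, one_mul, Complex.norm_real, Real.norm_eq_abs]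
    gcongr; exact norm_posFT_le _ _

end Spectral

/-! ### Circular components and the spectral form of the force. -/

section Circular

variable {A : Type*} [Ring A] [StarRing A] [Algebra ℂ A] [StarModule ℂ A]

/-- The circular component `u_x + iσ u_y` of a planar vector `u`. -/
def circ (σ : ℝ) (u : Fin 2 → A) : A := u 0 + (Complex.I * σ) • u 1

variable {E : QuantumState A} {p : Params} {μ : FrictionKernel} {f : Fin 2 → 𝓢(ℝ, ℝ) →ₗ[ℝ] A}
  {r : Fin 2 → ℝ → A}

theorem IsSteadyState.continuous_expect (hr : IsSteadyState p μ E f r) (a : A) (i : Fin 2) :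
    Continuous fun t => E.expect (a * r i t) := by
  rw [continuous_iff_continuousAt]
  intro t
  rw [ContinuousAt, tendsto_iff_norm_sub_tendsto_zero]
  have h := ((hr.continuous i t).const_mul (E.meanSq (star a))).sqrt
  rw [mul_zero, Real.sqrt_zero] at h
  refine squeeze_zero (fun _ => norm_nonneg _) (fun s => ?_) h
  refine Real.le_sqrt_of_sq_le ?_
  rw [← map_sub, ← mul_sub]
  exact E.norm_expect_mul_sq_le a (r i s - r i t)

/-- Stationarity makes the mean square constant, so Cauchy-Schwarz is uniform in time. -/
theorem IsSteadyState.exists_bound_expect (hr : IsSteadyState p μ E f r) (a : A) (i : Fin 2) :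
    ∃ C, ∀ t, ‖E.expect (a * r i t)‖ ≤ C := by
  refine ⟨√(E.meanSq (star a) * E.meanSq (r i 0)), fun t => Real.le_sqrt_of_sq_le ?_⟩
  have h := hr.stationary i i 0 0 t
  rw [zero_add] at h
  have h0 : E.meanSq (r i 0) = E.meanSq (r i t) := by
    rw [QuantumState.meanSq, QuantumState.meanSq, (hr.selfAdjoint i 0).star_eq,
      (hr.selfAdjoint i t).star_eq, h]
  rw [h0]
  exact E.norm_expect_mul_sq_le a (r i t)

/-- The Langevin equation for the circular components decouples. -/
theorem IsSteadyState.langevin_circ (hr : IsSteadyState p μ E f r) (a : A) {σ : ℝ}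
    (hσ : σ ^ 2 = 1) (g : 𝓢(ℝ, ℝ)) :
    (∫ t, (p.m : ℂ) * E.expect (a * circ σ (fun i => r i t)) *
          ((iteratedDeriv 2 (fun u => g u) t : ℝ) : ℂ))
      - (∫ t, ((μ.inst : ℂ) * E.expect (a * circ σ (fun i => r i t))
            + ∫ s in Ioi (0 : ℝ), (μ.mem s : ℂ) * E.expect (a * circ σ (fun i => r i (t - s))))
              * ((deriv (fun u => g u) t : ℝ) : ℂ))
      + (∫ t, (p.m * p.ω₀ ^ 2 : ℂ) * E.expect (a * circ σ (fun i => r i t)) * ((g t : ℝ) : ℂ))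
      + (∫ t, (p.e / p.c : ℂ) * (-(Complex.I * σ) * p.B * E.expect (a * circ σ (fun i => r i t)))
            * ((deriv (fun u => g u) t : ℝ) : ℂ))
      = E.expect (a * circ σ (fun i => f i g)) := by
  have hσ' : (σ : ℂ) ^ 2 = 1 := by exact_mod_cast hσ
  have hcirc : ∀ u : Fin 2 → A, E.expect (a * circ σ u) =
      E.expect (a * u 0) + (Complex.I * σ) * E.expect (a * u 1) := fun u => by
    simp [circ, mul_add]
  have h0 := hr.langevin a 0 g
  have h1 := hr.langevin a 1 g
  simp only [hcirc]
  rw [← h0, ← h1]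
  set e : Fin 2 → ℝ → ℂ := fun i t => E.expect (a * r i t) with he
  have hc : ∀ i, Continuous (e i) := hr.continuous_expect a
  choose C hC using hr.exists_bound_expect a
  have hC : ∀ i t, ‖e i t‖ ≤ C i := hC
  have hi : ∀ (i : Fin 2) (φ : ℝ → ℝ), Integrable φ → Integrable fun t => e i t * (φ t : ℂ) :=
    fun i φ hφ => hφ.ofReal.bdd_mul (hc i).aestronglyMeasurable (Eventually.of_forall (hC i))
  have hmem : ∀ i t, IntegrableOn (fun s => (μ.mem s : ℂ) * e i (t - s)) (Ioi 0) := fun i t =>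
    μ.integrable_mem.ofReal.mul_bdd
      ((hc i).comp (continuous_const.sub continuous_id)).aestronglyMeasurable
      (Eventually.of_forall fun s => hC i (t - s))
  set M : Fin 2 → ℝ → ℂ := fun i t => ∫ s in Ioi (0 : ℝ), (μ.mem s : ℂ) * e i (t - s) with hM
  have hMc : ∀ i, Continuous (M i) := fun i => by
    refine continuous_of_dominated (bound := fun s => ‖μ.mem s‖ * C i)
      (fun t => (hmem i t).aestronglyMeasurable) (fun t => Eventually.of_forall fun s => ?_)
      (μ.integrable_mem.norm.mul_const _) (Eventually.of_forall fun s => ?_)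
    · rw [norm_mul, Complex.norm_real]
      gcongr; exact hC i _
    · have := hc i
      fun_prop
  have hMb : ∀ i t, ‖M i t‖ ≤ ∫ s in Ioi (0 : ℝ), ‖μ.mem s‖ * C i := fun i t => by
    refine norm_integral_le_of_norm_le (μ.integrable_mem.norm.mul_const _)
      (Eventually.of_forall fun s => ?_)
    rw [norm_mul, Complex.norm_real]
    gcongr; exact hC i _
  have hMi : ∀ (i : Fin 2) (φ : ℝ → ℝ), Integrable φ → Integrable fun t => M i t * (φ t : ℂ) :=
    fun i φ hφ => hφ.ofReal.bdd_mul (hMc i).aestronglyMeasurable (Eventually.of_forall (hMb i))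
  have hMlin : ∀ t, ∫ s in Ioi (0 : ℝ), (μ.mem s : ℂ) *
      (e 0 (t - s) + Complex.I * σ * e 1 (t - s)) = M 0 t + Complex.I * σ * M 1 t := fun t => by
    simp only [hM]
    rw [← integral_const_mul, ← integral_add (hmem 0 t) ((hmem 1 t).const_mul _)]
    congr 1; ext s; ring
  have split : ∀ (u v : ℝ → ℂ) (k : ℂ), Integrable u → Integrable v →
      ∫ t, (u t + k * v t) = (∫ t, u t) + k * ∫ t, v t := fun u v k hu hv => by
    rw [integral_add hu (hv.const_mul k), integral_const_mul]
  have d2 := integrable_iteratedDeriv_two_schwartz g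
  have d1 := integrable_deriv_schwartz g
  have d0 : Integrable (fun t => g t) := g.integrable
  have s1 := split (fun t => (p.m : ℂ) * e 0 t * ((iteratedDeriv 2 (fun u => g u) t : ℝ) : ℂ))
    (fun t => (p.m : ℂ) * e 1 t * ((iteratedDeriv 2 (fun u => g u) t : ℝ) : ℂ)) (Complex.I * σ)
    (by simpa only [mul_assoc] using (hi 0 _ d2).const_mul (p.m : ℂ))
    (by simpa only [mul_assoc] using (hi 1 _ d2).const_mul (p.m : ℂ))
  have hMM : ∀ i, Integrable fun t => ((μ.inst : ℂ) * e i t + M i t) *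
      ((deriv (fun u => g u) t : ℝ) : ℂ) := fun i => by
    have := ((hi i _ d1).const_mul (μ.inst : ℂ)).add (hMi i _ d1)
    refine this.congr (Eventually.of_forall fun t => ?_)
    simp only [Pi.add_apply]
    ring
  have s2 := split (fun t => ((μ.inst : ℂ) * e 0 t + M 0 t) * ((deriv (fun u => g u) t : ℝ) : ℂ))
    (fun t => ((μ.inst : ℂ) * e 1 t + M 1 t) * ((deriv (fun u => g u) t : ℝ) : ℂ)) (Complex.I * σ)
    (hMM 0) (hMM 1)
  have s3 := split (fun t => (p.m * p.ω₀ ^ 2 : ℂ) * e 0 t * ((g t : ℝ) : ℂ))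
    (fun t => (p.m * p.ω₀ ^ 2 : ℂ) * e 1 t * ((g t : ℝ) : ℂ)) (Complex.I * σ)
    (((hi 0 _ d0).const_mul (p.m * p.ω₀ ^ 2 : ℂ)).congr
      (Eventually.of_forall fun t => by simp only; ring))
    (((hi 1 _ d0).const_mul (p.m * p.ω₀ ^ 2 : ℂ)).congr
      (Eventually.of_forall fun t => by simp only; ring))
  have s4 := split
    (fun t => (p.e / p.c : ℂ) * (p.B * e 1 t) * ((deriv (fun u => g u) t : ℝ) : ℂ))
    (fun t => (p.e / p.c : ℂ) * -(p.B * e 0 t) * ((deriv (fun u => g u) t : ℝ) : ℂ))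
    (Complex.I * σ)
    (by
      refine ((hi 1 _ d1).const_mul (p.e / p.c * p.B : ℂ)).congr (Eventually.of_forall fun t => ?_)
      simp only; ring)
    (by
      refine ((hi 0 _ d1).const_mul (-(p.e / p.c * p.B) : ℂ)).congr
        (Eventually.of_forall fun t => ?_)
      simp only; ring)
  have c0 : ∀ u : Fin 2 → ℂ, crossField p.B u 0 = p.B * u 1 := fun u => rfl
  have c1 : ∀ u : Fin 2 → ℂ, crossField p.B u 1 = -(p.B * u 0) := fun u => rfl
  simp only [c0, c1]
  have t1 : ∫ t, (p.m : ℂ) * (e 0 t + Complex.I * σ * e 1 t) *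
      ((iteratedDeriv 2 (fun u => g u) t : ℝ) : ℂ) = _ := Eq.trans (by congr 1; ext t; ring) s1
  have t2 : ∫ t, ((μ.inst : ℂ) * (e 0 t + Complex.I * σ * e 1 t) + ∫ s in Ioi (0 : ℝ),
      (μ.mem s : ℂ) * (e 0 (t - s) + Complex.I * σ * e 1 (t - s))) *
      ((deriv (fun u => g u) t : ℝ) : ℂ) = _ :=
    Eq.trans (by congr 1; ext t; rw [hMlin]; ring) s2
  have t3 : ∫ t, (p.m * p.ω₀ ^ 2 : ℂ) * (e 0 t + Complex.I * σ * e 1 t) * ((g t : ℝ) : ℂ) = _ :=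
    Eq.trans (by congr 1; ext t; ring) s3
  -- The circular combinations diagonalize the rotation `(u₀, u₁) ↦ (u₁, -u₀)`: as `σ² = 1`, `u₁ -
  -- iσu₀ = -iσ(u₀ + iσu₁)`.
  have t4 : ∫ t, (p.e / p.c : ℂ) * (-(Complex.I * σ) * p.B * (e 0 t + Complex.I * σ * e 1 t)) *
      ((deriv (fun u => g u) t : ℝ) : ℂ) = _ :=
    Eq.trans (by
      congr 1; ext t
      linear_combination
        (-(p.e / p.c * p.B * σ ^ 2 * e 1 t * ((deriv (fun u => g u) t : ℝ) : ℂ)) : ℂ) *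
          Complex.I_sq +
        (p.e / p.c * p.B * e 1 t * ((deriv (fun u => g u) t : ℝ) : ℂ)) * hσ') s4
  have L : ∀ a1 a2 a3 a4 b1 b2 b3 b4 c1 c2 c3 c4 k : ℂ, a1 = b1 + k * c1 → a2 = b2 + k * c2 →
      a3 = b3 + k * c3 → a4 = b4 + k * c4 →
      a1 - a2 + a3 + a4 = b1 - b2 + b3 + b4 + k * (c1 - c2 + c3 + c4) := by
    intros; subst_vars; ring
  exact L _ _ _ _ _ _ _ _ _ _ _ _ _ t1 t2 t3 t4

/-- In terms of the spectral measure of a circular component of the position, the force has the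
spectral density `|symbol|²`. -/
theorem IsSteadyState.expect_force (hr : IsSteadyState p μ E f r) {σ : ℝ} (hσ : σ ^ 2 = 1)
    {ρ : Measure ℝ} [IsFiniteMeasure ρ]
    (hρ : ∀ s t, E.expect (star (circ σ fun i => r i s) * circ σ fun i => r i t) =
      charFun ρ (t - s)) (g h : 𝓢(ℝ, ℝ)) :
    E.expect (star (circ σ fun i => f i h) * circ σ fun i => f i g) =
      ∫ ω, conj (langevinSymbol p μ σ ω * posFT h ω) * (langevinSymbol p μ σ ω * posFT g ω) ∂ρ := by
  -- Used twice: with `a` the adjoint of a position, whose density is a pure phase, and then with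
  -- `a` the adjoint of a force.
  have step : ∀ (a : A) (b : ℝ → ℂ) (g : 𝓢(ℝ, ℝ)), Integrable b ρ →
      (∀ t, E.expect (a * circ σ fun i => r i t) = spectralFun ρ b t) →
      E.expect (a * circ σ fun i => f i g) =
        ∫ ω, b ω * (langevinSymbol p μ σ ω * posFT g ω) ∂ρ := by
    intro a b g hb hab
    rw [← langevin_spectralFun p μ σ hb g, ← hr.langevin_circ a hσ g]
    simp only [hab]
  have hb1 : ∀ s : ℝ, Integrable (fun ω : ℝ => Complex.exp (ω * (-s : ℝ) * Complex.I)) ρ :=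
    fun s => Integrable.of_bound (Continuous.aestronglyMeasurable (by fun_prop)) 1
      (Eventually.of_forall fun ω => (norm_exp_mul_mul_I ω _).le)
  have h1 : ∀ s, E.expect (star (circ σ fun i => r i s) * circ σ fun i => f i h) =
      ∫ ω : ℝ, Complex.exp (ω * (-s : ℝ) * Complex.I) *
        (langevinSymbol p μ σ ω * posFT h ω) ∂ρ := fun s => by
    refine step _ _ h (hb1 s) fun t => ?_
    rw [hρ, charFun_apply_real, spectralFun]
    congr 1; ext ω
    rw [← Complex.exp_add]
    congr 1; push_cast; ring
  obtain ⟨C, hC⟩ := exists_bound_langevinSymbol_mul_posFT p μ σ h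
  have hcont : Continuous fun ω => langevinSymbol p μ σ ω * posFT h ω :=
    (continuous_langevinSymbol p μ σ).mul (continuous_posFT h.integrable)
  -- Conjugating the position-force correlation `h1` supplies the density of the force-position
  -- correlation.
  refine step _ (fun ω => conj (langevinSymbol p μ σ ω * posFT h ω)) g
    (Integrable.of_bound (Complex.continuous_conj.comp hcont).aestronglyMeasurable C
      (Eventually.of_forall fun ω => by rw [RCLike.norm_conj]; exact hC ω)) fun s => ?_
  have h2 := congrArg conj (h1 s)
  rw [E.conj_expect, star_mul, star_star, ← integral_conj] at h2
  rw [h2, spectralFun]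
  congr 1; ext ω
  rw [map_mul, ← Complex.exp_conj]
  congr 2
  simp

end Circular

/-! ### Elementary bounds for the hyperbolic cotangent. -/

section Coth

theorem measurable_coth : Measurable coth := by
  unfold coth
  exact Real.measurable_cosh.div Real.measurable_sinh

theorem coth_neg (x : ℝ) : coth (-x) = -coth x := by
  simp [coth, div_neg]

theorem one_le_coth {x : ℝ} (hx : 0 < x) : 1 ≤ coth x := by
  have hs := Real.sinh_pos_iff.mpr hx
  rw [coth, one_le_div hs]
  exact (Real.sinh_lt_cosh x).le

theorem mul_coth_le_of_pos {x : ℝ} (hx : 0 < x) : x * coth x ≤ 1 + x := by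
  have hs := Real.sinh_pos_iff.mpr hx
  rw [coth, ← mul_div_assoc, div_le_iff₀ hs]
  have h1 : Real.cosh x - Real.sinh x = Real.exp (-x) := by
    rw [Real.cosh_sub_sinh]
  have h2 : Real.exp (-x) ≤ 1 := Real.exp_le_one_iff.mpr (by linarith)
  have h3 : x ≤ Real.sinh x := Real.self_le_sinh_iff.mpr hx.le
  nlinarith [mul_le_mul_of_nonneg_left h2 hx.le]

/-- `coth` is at least `1` on the right and at most `-1` on the left. This makes the noise density
nonnegative at frequencies of both signs. -/
theorem mul_coth_add_one_nonneg (x : ℝ) : 0 ≤ x * (coth x + 1) := by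
  rcases lt_trichotomy x 0 with h | h | h
  · have := one_le_coth (neg_pos.mpr h)
    rw [coth_neg] at this
    exact mul_nonneg_of_nonpos_of_nonpos h.le (by linarith)
  · simp [h]
  · exact mul_nonneg h.le (by linarith [one_le_coth h])

theorem abs_mul_coth_le (x : ℝ) : |x * coth x| ≤ 1 + |x| := by
  rcases lt_trichotomy x 0 with h | h | h
  · have h1 := mul_coth_le_of_pos (neg_pos.mpr h)
    have h2 := one_le_coth (neg_pos.mpr h)
    rw [coth_neg] at h1 h2
    rw [abs_of_neg h, abs_of_nonneg (mul_nonneg_of_nonpos_of_nonpos h.le (by linarith))]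
    linarith
  · simp [h]
  · rw [abs_of_pos h, abs_of_nonneg (mul_nonneg h.le (by linarith [one_le_coth h]))]
    exact mul_coth_le_of_pos h

end Coth

/-! ### Smeared sine and cosine kernels. -/

section Correlation

theorem re_posFT {φ : ℝ → ℝ} (hφ : Integrable φ) (ω : ℝ) :
    (posFT φ ω).re = ∫ t, φ t * Real.cos (ω * t) := by
  have h : (posFT φ ω).re = ∫ t : ℝ, (Complex.exp (ω * t * Complex.I) * φ t).re :=
    (integral_re (integrable_exp_mul hφ ω)).symm
  rw [h]
  congr 1; ext t
  rw [← Complex.ofReal_mul, Complex.re_mul_ofReal, Complex.exp_ofReal_mul_I_re, mul_comm]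

theorem im_posFT {φ : ℝ → ℝ} (hφ : Integrable φ) (ω : ℝ) :
    (posFT φ ω).im = ∫ t, φ t * Real.sin (ω * t) := by
  have h : (posFT φ ω).im = ∫ t : ℝ, (Complex.exp (ω * t * Complex.I) * φ t).im :=
    (integral_im (integrable_exp_mul hφ ω)).symm
  rw [h]
  congr 1; ext t
  rw [← Complex.ofReal_mul, Complex.im_mul_ofReal, Complex.exp_ofReal_mul_I_im, mul_comm]

theorem integrable_mul_cos {φ : ℝ → ℝ} (hφ : Integrable φ) (ω : ℝ) :
    Integrable fun t => φ t * Real.cos (ω * t) :=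
  hφ.mul_bdd (c := 1) (Continuous.aestronglyMeasurable (by fun_prop))
    (Eventually.of_forall fun t => by simpa using Real.abs_cos_le_one (ω * t))

theorem integrable_mul_sin {φ : ℝ → ℝ} (hφ : Integrable φ) (ω : ℝ) :
    Integrable fun t => φ t * Real.sin (ω * t) :=
  hφ.mul_bdd (c := 1) (Continuous.aestronglyMeasurable (by fun_prop))
    (Eventually.of_forall fun t => by simpa using Real.abs_sin_le_one (ω * t))

theorem integral_integral_cos {φ ψ : ℝ → ℝ} (hφ : Integrable φ) (hψ : Integrable ψ) (ω : ℝ) :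
    ∫ t, ∫ t', φ t * ψ t' * Real.cos (ω * (t - t')) = (conj (posFT φ ω) * posFT ψ ω).re := by
  have h1 : ∀ t, ∫ t', φ t * ψ t' * Real.cos (ω * (t - t')) =
      φ t * Real.cos (ω * t) * (posFT ψ ω).re + φ t * Real.sin (ω * t) * (posFT ψ ω).im :=
    fun t => by
    rw [re_posFT hψ, im_posFT hψ, ← integral_const_mul, ← integral_const_mul,
      ← integral_add ((integrable_mul_cos hψ ω).const_mul _) ((integrable_mul_sin hψ ω).const_mul _)]
    congr 1; ext t'
    rw [mul_sub, Real.cos_sub]; ring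
  simp only [h1]
  rw [integral_add ((integrable_mul_cos hφ ω).mul_const _) ((integrable_mul_sin hφ ω).mul_const _),
    integral_mul_const, integral_mul_const, ← re_posFT hφ, ← im_posFT hφ]
  simp

/-- The product of transforms carries the phase `e^{iω(t'-t)}`, whose imaginary part is
`-sin(ω(t-t'))`; hence the sign. -/
theorem integral_integral_sin {φ ψ : ℝ → ℝ} (hφ : Integrable φ) (hψ : Integrable ψ) (ω : ℝ) :
    ∫ t, ∫ t', φ t * ψ t' * Real.sin (ω * (t - t')) = -(conj (posFT φ ω) * posFT ψ ω).im := by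
  have h1 : ∀ t, ∫ t', φ t * ψ t' * Real.sin (ω * (t - t')) =
      φ t * Real.sin (ω * t) * (posFT ψ ω).re - φ t * Real.cos (ω * t) * (posFT ψ ω).im :=
    fun t => by
    rw [re_posFT hψ, im_posFT hψ, ← integral_const_mul, ← integral_const_mul,
      ← integral_sub ((integrable_mul_cos hψ ω).const_mul _) ((integrable_mul_sin hψ ω).const_mul _)]
    congr 1; ext t'
    rw [mul_sub, Real.sin_sub]; ring
  simp only [h1]
  rw [integral_sub ((integrable_mul_sin hφ ω).mul_const _) ((integrable_mul_cos hφ ω).mul_const _),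
    integral_mul_const, integral_mul_const, ← re_posFT hφ, ← im_posFT hφ]
  simp
  ring

end Correlation

/-! ### The spectral density of the thermal noise. -/

section Noise

variable (p : Params) (μ : FrictionKernel)

/-- The spectral density of the thermal noise, in the convention
`⟨f(s) f(t)⟩ = ∫ e^{iω(t-s)} (noise density) dω`. -/
def noiseDensity (ω : ℝ) : ℝ :=
  p.ħ * ω / (2 * Real.pi) * (μ.ft ω).re * (coth (p.ħ * ω / (2 * p.kB * p.T)) + 1)

variable {p μ}

theorem noiseDensity_nonneg (hμ : ∀ ω : ℝ, ω ≠ 0 → 0 < (μ.ft ω).re) (ω : ℝ) :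
    0 ≤ noiseDensity p μ ω := by
  rcases eq_or_ne ω 0 with h | h
  · simp [noiseDensity, h]
  have h1 := mul_coth_add_one_nonneg (p.ħ * ω / (2 * p.kB * p.T))
  have h2 := hμ ω h
  have := p.kB_pos
  have := p.T_pos
  have e : noiseDensity p μ ω = 2 * p.kB * p.T / (2 * Real.pi) * (μ.ft ω).re *
      (p.ħ * ω / (2 * p.kB * p.T) * (coth (p.ħ * ω / (2 * p.kB * p.T)) + 1)) := by
    rw [noiseDensity]; field_simp
  rw [e]
  have := Real.pi_pos
  positivity

variable (p μ)

theorem measurable_re_ft : Measurable fun ω => (μ.ft ω).re :=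
  (Complex.continuous_re.comp (continuous_ft μ)).measurable

theorem measurable_coth_comp : Measurable fun ω : ℝ => coth (p.ħ * ω / (2 * p.kB * p.T)) :=
  measurable_coth.comp (by fun_prop)

theorem measurable_noiseDensity : Measurable (noiseDensity p μ) := by
  have h1 := measurable_re_ft μ
  have h2 := measurable_coth_comp p
  unfold noiseDensity
  fun_prop

/-- Functions of at most linear growth are integrable against the square of the transform of the
Gaussian. -/
theorem integrable_mul_sq_posFT_gaussian {u : ℝ → ℝ} (hu : Measurable u) {C : ℝ}
    (hC : ∀ ω, |u ω| ≤ C * (1 + |ω|)) :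
    Integrable fun ω => u ω * (Real.sqrt (2 * Real.pi) * Real.exp (-(ω ^ 2 / 2))) ^ 2 := by
  have hC0 : 0 ≤ C := by
    have := (abs_nonneg _).trans (hC 0)
    simpa using this
  have hi : Integrable fun ω : ℝ => C * (2 * (2 * Real.pi)) * Real.exp (-(1 / 2) * ω ^ 2) :=
    (integrable_exp_neg_mul_sq (by norm_num)).const_mul _
  refine hi.mono' (by
    have : Measurable fun ω => u ω * (Real.sqrt (2 * Real.pi) * Real.exp (-(ω ^ 2 / 2))) ^ 2 := by
      fun_prop
    exact this.aestronglyMeasurable) (Eventually.of_forall fun ω => ?_)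
  have h1 : 1 + |ω| ≤ 2 * Real.exp (ω ^ 2 / 2) := by
    have := Real.add_one_le_exp (ω ^ 2 / 2)
    nlinarith [sq_nonneg (|ω| - 1), sq_abs ω]
  have h2 : Real.exp (ω ^ 2 / 2) * Real.exp (-(ω ^ 2 / 2)) ^ 2 = Real.exp (-(1 / 2) * ω ^ 2) := by
    rw [sq (Real.exp _), ← Real.exp_add, ← Real.exp_add]; congr 1; ring
  rw [norm_mul, Real.norm_eq_abs, Real.norm_of_nonneg (by positivity), mul_pow,
    Real.sq_sqrt (by positivity)]
  calc |u ω| * (2 * Real.pi * Real.exp (-(ω ^ 2 / 2)) ^ 2)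
      ≤ (C * (2 * Real.exp (ω ^ 2 / 2))) * (2 * Real.pi * Real.exp (-(ω ^ 2 / 2)) ^ 2) := by
        gcongr
        exact (hC ω).trans (by gcongr)
    _ = C * (2 * (2 * Real.pi)) * (Real.exp (ω ^ 2 / 2) * Real.exp (-(ω ^ 2 / 2)) ^ 2) := by ring
    _ = _ := by rw [h2]

theorem exists_bound_noise_coth :
    ∃ C, ∀ ω, |p.ħ * ω * (μ.ft ω).re * coth (p.ħ * ω / (2 * p.kB * p.T))| ≤ C * (1 + |ω|) := by
  have hk := p.kB_pos
  have hT := p.T_pos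
  have hh := p.ħ_pos
  set D := |μ.inst| + ∫ s in Ioi (0 : ℝ), ‖μ.mem s‖
  refine ⟨(2 * p.kB * p.T + p.ħ) * D, fun ω => ?_⟩
  have hD : |(μ.ft ω).re| ≤ D := (Complex.abs_re_le_norm _).trans (norm_ft_le μ ω)
  have h1 := abs_mul_coth_le (p.ħ * ω / (2 * p.kB * p.T))
  have e : p.ħ * ω * (μ.ft ω).re * coth (p.ħ * ω / (2 * p.kB * p.T)) = 2 * p.kB * p.T *
      (p.ħ * ω / (2 * p.kB * p.T) * coth (p.ħ * ω / (2 * p.kB * p.T))) * (μ.ft ω).re := by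
    field_simp
  have h2 : |2 * p.kB * p.T| = 2 * p.kB * p.T := abs_of_pos (by positivity)
  rw [e, abs_mul, abs_mul, h2]
  have h3 : 2 * p.kB * p.T * (1 + |p.ħ * ω / (2 * p.kB * p.T)|) = 2 * p.kB * p.T + p.ħ * |ω| := by
    rw [abs_div, h2, abs_mul, abs_of_pos hh]; field_simp
  calc _ ≤ (2 * p.kB * p.T * (1 + |p.ħ * ω / (2 * p.kB * p.T)|)) * D := by gcongr
    _ = (2 * p.kB * p.T + p.ħ * |ω|) * D := by rw [h3]
    _ ≤ ((2 * p.kB * p.T + p.ħ) * (1 + |ω|)) * D := by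
      have : 0 ≤ D := (abs_nonneg _).trans hD
      gcongr
      have := mul_nonneg (by positivity : 0 ≤ 2 * p.kB * p.T) (abs_nonneg ω)
      nlinarith
    _ = _ := by ring

theorem exists_bound_noise :
    ∃ C, ∀ ω, |p.ħ * ω * (μ.ft ω).re| ≤ C * (1 + |ω|) := by
  have hh := p.ħ_pos
  set D := |μ.inst| + ∫ s in Ioi (0 : ℝ), ‖μ.mem s‖
  refine ⟨p.ħ * D, fun ω => ?_⟩
  have hD : |(μ.ft ω).re| ≤ D := (Complex.abs_re_le_norm _).trans (norm_ft_le μ ω)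
  rw [abs_mul, abs_mul, abs_of_pos hh]
  calc p.ħ * |ω| * |(μ.ft ω).re| ≤ p.ħ * (1 + |ω|) * D := by
        gcongr; linarith
    _ = _ := by ring

theorem integrable_noise_coth : Integrable fun ω => p.ħ * ω * (μ.ft ω).re *
    coth (p.ħ * ω / (2 * p.kB * p.T)) *
      (Real.sqrt (2 * Real.pi) * Real.exp (-(ω ^ 2 / 2))) ^ 2 := by
  obtain ⟨C, hC⟩ := exists_bound_noise_coth p μ
  have h1 := measurable_re_ft μ
  have h2 := measurable_coth_comp p
  exact integrable_mul_sq_posFT_gaussian (by fun_prop) hC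

theorem integrable_noise : Integrable fun ω => p.ħ * ω * (μ.ft ω).re *
      (Real.sqrt (2 * Real.pi) * Real.exp (-(ω ^ 2 / 2))) ^ 2 := by
  obtain ⟨C, hC⟩ := exists_bound_noise p μ
  have h1 := measurable_re_ft μ
  exact integrable_mul_sq_posFT_gaussian (by fun_prop) hC

theorem integrable_noiseDensity_mul : Integrable fun ω => noiseDensity p μ ω *
      (Real.sqrt (2 * Real.pi) * Real.exp (-(ω ^ 2 / 2))) ^ 2 := by
  refine (((integrable_noise_coth p μ).add (integrable_noise p μ)).const_mul
    (1 / (2 * Real.pi))).congr (Eventually.of_forall fun ω => ?_)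
  simp only [Pi.add_apply, noiseDensity]
  ring

/-- Folds the spectral integral onto the half-line on which the anticommutator and commutator are
prescribed. -/
theorem integral_eq_integral_Ioi_add_neg {F : ℝ → ℂ} (hF : Integrable F) :
    ∫ ω, F ω = ∫ ω in Ioi (0 : ℝ), (F ω + F (-ω)) := by
  have h1 := integral_comp_neg_Ioi (0 : ℝ) F
  rw [neg_zero] at h1
  rw [integral_add hF.integrableOn hF.comp_neg.integrableOn, h1, add_comm,
    intervalIntegral.integral_Iic_add_Ioi hF.integrableOn hF.integrableOn]

variable {A : Type*} [Ring A] [StarRing A] [Algebra ℂ A] [StarModule ℂ A]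
  {E : QuantumState A} {f : Fin 2 → 𝓢(ℝ, ℝ) →ₗ[ℝ] A}

variable {p μ}

/-- The correlation of a circular component of the thermal noise smeared with a Gaussian and with
its translate. -/
theorem IsThermalNoise.expect_circ (hf : IsThermalNoise p μ E f) {σ : ℝ} (hσ : σ ^ 2 = 1) (a : ℝ) :
    E.expect (star (circ σ fun i => f i gaussian) *
        circ σ fun i => f i (SchwartzMap.compSubConstCLM ℝ a gaussian)) =
      ∫ ω : ℝ, Complex.exp (a * ω * Complex.I) * ((2 * (noiseDensity p μ ω *
        (Real.sqrt (2 * Real.pi) * Real.exp (-(ω ^ 2 / 2))) ^ 2) : ℝ) : ℂ) := by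
  have hσ' : (σ : ℂ) ^ 2 = 1 := by exact_mod_cast hσ
  set g := SchwartzMap.compSubConstCLM ℝ a gaussian with hg
  set γ : ℝ → ℝ := fun ω => Real.sqrt (2 * Real.pi) * Real.exp (-(ω ^ 2 / 2)) with hγ
  set N : ℝ → ℝ := fun ω => p.ħ * ω * (μ.ft ω).re with hN
  set x : ℝ → ℝ := fun ω => coth (p.ħ * ω / (2 * p.kB * p.T)) with hx
  -- An ordered product is half the anticommutator plus half the commutator; these produce the
  -- `coth` and the `1` in `noiseDensity`.
  have hsplit : ∀ i j, E.expect (f i gaussian * f j g) =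
      (1 / 2) * (E.expect (f i gaussian * f j g + f j g * f i gaussian) +
        E.expect (f i gaussian * f j g - f j g * f i gaussian)) := fun i j => by
    rw [← map_add]
    have : f i gaussian * f j g + f j g * f i gaussian +
        (f i gaussian * f j g - f j g * f i gaussian) = (2 : ℂ) • (f i gaussian * f j g) := by
      rw [two_smul]; abel
    rw [this, map_smul, smul_eq_mul]; ring
  have hoff : ∀ i j, i ≠ j → E.expect (f i gaussian * f j g) = 0 := fun i j hij => by
    rw [hsplit, hf.anticommutator, hf.commutator, if_neg hij, if_neg hij]; ring
  have hP : ∀ ω, conj (posFT gaussian ω) * posFT g ω =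
      ((γ ω) ^ 2 : ℝ) * Complex.exp ((ω * a : ℝ) * Complex.I) := fun ω => by
    have : posFT g ω = Complex.exp (ω * a * Complex.I) * posFT gaussian ω :=
      posFT_comp_sub gaussian a ω
    rw [this, posFT_gaussian, Complex.conj_ofReal]
    simp only [hγ]
    push_cast; ring
  have hcos : ∀ ω, ∫ t, ∫ t', gaussian t * g t' * Real.cos (ω * (t - t')) =
      (γ ω) ^ 2 * Real.cos (ω * a) := fun ω => by
    rw [integral_integral_cos gaussian.integrable g.integrable, hP, Complex.re_ofReal_mul,
      Complex.exp_ofReal_mul_I_re]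
  have hsin : ∀ ω, ∫ t, ∫ t', gaussian t * g t' * Real.sin (ω * (t - t')) =
      -((γ ω) ^ 2 * Real.sin (ω * a)) := fun ω => by
    rw [integral_integral_sin gaussian.integrable g.integrable, hP, Complex.im_ofReal_mul,
      Complex.exp_ofReal_mul_I_im]
  have ic : Integrable fun ω => N ω * x ω * ((γ ω) ^ 2 * Real.cos (ω * a)) := by
    refine (integrable_mul_cos (integrable_noise_coth p μ) a).congr
      (Eventually.of_forall fun ω => ?_)
    simp only [hN, hx, hγ, mul_comm a]; ring
  have is : Integrable fun ω => N ω * -((γ ω) ^ 2 * Real.sin (ω * a)) := by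
    refine (integrable_mul_sin (integrable_noise p μ) a).neg.congr
      (Eventually.of_forall fun ω => ?_)
    simp only [hN, hγ, mul_comm a, Pi.neg_apply]; ring
  have hdiag : ∀ i, E.expect (f i gaussian * f i g) =
      ∫ ω : ℝ, Complex.exp (a * ω * Complex.I) * ((noiseDensity p μ ω * (γ ω) ^ 2 : ℝ) : ℂ) :=
    fun i => by
    rw [hsplit, hf.anticommutator, hf.commutator, if_pos rfl, if_pos rfl]
    simp only [hcos, hsin]
    rw [integral_eq_integral_Ioi_add_neg]
    · rw [← integral_complex_ofReal, ← integral_complex_ofReal]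
      have e1 : (1 / 2 : ℂ) * (2 / (Real.pi : ℂ) *
            (∫ ω in Ioi (0 : ℝ), ((N ω * x ω * ((γ ω) ^ 2 * Real.cos (ω * a)) : ℝ) : ℂ)) +
          2 / (Complex.I * (Real.pi : ℂ)) *
            (∫ ω in Ioi (0 : ℝ), ((N ω * -((γ ω) ^ 2 * Real.sin (ω * a)) : ℝ) : ℂ))) =
          ∫ ω in Ioi (0 : ℝ), ((1 / (Real.pi : ℂ)) *
            ((N ω * x ω * ((γ ω) ^ 2 * Real.cos (ω * a)) : ℝ) : ℂ) +
            (-Complex.I / (Real.pi : ℂ)) * ((N ω * -((γ ω) ^ 2 * Real.sin (ω * a)) : ℝ) : ℂ)) := by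
        rw [integral_add (ic.integrableOn.ofReal.const_mul _) (is.integrableOn.ofReal.const_mul _),
          integral_const_mul, integral_const_mul]
        have : (2 : ℂ) / (Complex.I * (Real.pi : ℂ)) = 2 * (-Complex.I / (Real.pi : ℂ)) := by
          rw [mul_comm Complex.I, ← div_div, Complex.div_I]; ring
        rw [this]; ring
      refine Eq.trans e1 ?_
      congr 1; ext ω
      have hE1 : Complex.exp (a * ω * Complex.I) =
          Complex.cos (ω * a) + Complex.sin (ω * a) * Complex.I := by
        rw [mul_comm (a : ℂ), Complex.exp_mul_I]
      have hE2 : Complex.exp (a * (-ω : ℝ) * Complex.I) =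
          Complex.cos (ω * a) - Complex.sin (ω * a) * Complex.I := by
        have : (a * (-ω : ℝ) * Complex.I : ℂ) = -(ω * a : ℂ) * Complex.I := by push_cast; ring
        rw [this, Complex.exp_mul_I, Complex.cos_neg, Complex.sin_neg]; ring
      have hn1 : noiseDensity p μ ω = 1 / (2 * Real.pi) * N ω * (x ω + 1) := by
        simp only [noiseDensity, hN, hx]; ring
      have hn2 : noiseDensity p μ (-ω) = 1 / (2 * Real.pi) * N ω * (x ω - 1) := by
        have : p.ħ * -ω / (2 * p.kB * p.T) = -(p.ħ * ω / (2 * p.kB * p.T)) := by ring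
        simp only [noiseDensity, hN, hx, ft_neg, Complex.conj_re, this, coth_neg]; ring
      have hγn : γ (-ω) = γ ω := by simp [hγ]
      rw [hE1, hE2, hn1, hn2, hγn]
      push_cast
      have : (Real.pi : ℂ) ≠ 0 := by exact_mod_cast Real.pi_ne_zero
      field_simp
      ring
    · exact (integrable_noiseDensity_mul p μ).ofReal.bdd_mul (c := 1)
        (Continuous.aestronglyMeasurable (by fun_prop))
        (Eventually.of_forall fun t => (norm_exp_mul_mul_I a t).le)
  -- The cross terms vanish and the two diagonal terms agree, which accounts for the factor `2` in
  -- the density.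
  have hexp : E.expect (star (circ σ fun i => f i gaussian) * circ σ fun i => f i g) =
      E.expect (f 0 gaussian * f 0 g) + (σ : ℂ) ^ 2 * E.expect (f 1 gaussian * f 1 g)
      + Complex.I * σ * (E.expect (f 0 gaussian * f 1 g) - E.expect (f 1 gaussian * f 0 g)) := by
    have h2 := Complex.I_sq
    simp only [circ, star_add, star_smul, (hf.selfAdjoint _ _).star_eq, add_mul, mul_add,
      smul_mul_assoc, mul_smul_comm, map_add, map_smul, smul_eq_mul, RCLike.star_def, map_mul,
      Complex.conj_I, Complex.conj_ofReal]
    linear_combination (-(σ : ℂ) ^ 2 * E.expect (f 1 gaussian * f 1 g)) * h2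
  rw [hexp, hoff 0 1 (by decide), hoff 1 0 (by decide), hdiag, hdiag, hσ', sub_zero, mul_zero,
    add_zero, one_mul, ← two_mul, ← integral_const_mul]
  congr 1; ext ω
  simp only [hγ]
  push_cast; ring

end Noise

/-! ### Identification of the spectral measure of the position. -/

section Identify

variable {A : Type*} [Ring A] [StarRing A] [Algebra ℂ A] [StarModule ℂ A]
  {E : QuantumState A} {p : Params} {μ : FrictionKernel} {f : Fin 2 → 𝓢(ℝ, ℝ) →ₗ[ℝ] A}
  {r : Fin 2 → ℝ → A}

theorem langevinSymbol_eq (σ ω : ℝ) : langevinSymbol p μ σ ω =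
    ((p.m * (p.ω₀ ^ 2 - ω ^ 2) - σ * (p.e / p.c * p.B) * ω : ℝ) : ℂ) +
      (ω : ℂ) * (Complex.I * μ.ft ω) := by
  rw [langevinSymbol]; push_cast; ring

theorem re_langevinSymbol (σ ω : ℝ) : (langevinSymbol p μ σ ω).re =
    p.m * (p.ω₀ ^ 2 - ω ^ 2) - σ * (p.e / p.c * p.B) * ω - ω * (μ.ft ω).im := by
  rw [langevinSymbol_eq, Complex.add_re, Complex.ofReal_re, Complex.re_ofReal_mul, Complex.I_mul_re]
  ring

theorem im_langevinSymbol (σ ω : ℝ) : (langevinSymbol p μ σ ω).im = ω * (μ.ft ω).re := by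
  rw [langevinSymbol_eq, Complex.add_im, Complex.ofReal_im, Complex.im_ofReal_mul, Complex.I_mul_im]
  ring

/-- Dissipation keeps the imaginary part nonzero off `ω = 0`, and the trap keeps the real part
positive at `ω = 0`. -/
theorem langevinSymbol_ne_zero (hμ : ∀ ω : ℝ, ω ≠ 0 → 0 < (μ.ft ω).re) (σ ω : ℝ) :
    langevinSymbol p μ σ ω ≠ 0 := by
  intro h
  rcases eq_or_ne ω 0 with h0 | h0
  · have h3 := re_langevinSymbol (p := p) (μ := μ) σ ω
    have h1 := p.m_pos
    have h2 := p.ω₀_pos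
    rw [h, h0, Complex.zero_re] at h3
    have : 0 < p.m * p.ω₀ ^ 2 := by positivity
    linarith
  · have h3 := im_langevinSymbol (p := p) (μ := μ) σ ω
    rw [h, Complex.zero_im] at h3
    exact mul_ne_zero h0 (hμ ω h0).ne' h3.symm

/-- The spectral measure of the circular components of the position. -/
theorem lintegral_spectralMeasure (hμ : ∀ ω : ℝ, ω ≠ 0 → 0 < (μ.ft ω).re)
    (hf : IsThermalNoise p μ E f) (hr : IsSteadyState p μ E f r) {σ : ℝ} (hσ : σ ^ 2 = 1)
    {ρ : Measure ℝ} [IsFiniteMeasure ρ]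
    (hρ : ∀ s t, E.expect (star (circ σ fun i => r i s) * circ σ fun i => r i t) =
      charFun ρ (t - s)) {u : ℝ → ENNReal} (hu : Measurable u) :
    ∫⁻ ω, u ω ∂ρ =
      ∫⁻ ω, u ω * ENNReal.ofReal (2 * noiseDensity p μ ω / ‖langevinSymbol p μ σ ω‖ ^ 2) := by
  set γ : ℝ → ℝ := fun ω => Real.sqrt (2 * Real.pi) * Real.exp (-(ω ^ 2 / 2)) with hγ
  have hγpos : ∀ ω, 0 < γ ω := fun ω => by simp only [hγ]; positivity
  have hγc : Continuous γ := by fun_prop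
  have hkc := continuous_langevinSymbol p μ σ
  have hkpos : ∀ ω, 0 < ‖langevinSymbol p μ σ ω‖ ^ 2 := fun ω => by
    have := norm_pos_iff.mpr (langevinSymbol_ne_zero (p := p) hμ σ ω)
    positivity
  -- The Gaussian weight makes both force spectra finite measures, so that characteristic functions
  -- determine them, and it never vanishes.
  set d₁ : ℝ → ℝ := fun ω => ‖langevinSymbol p μ σ ω‖ ^ 2 * γ ω ^ 2 with hd₁
  set d₂ : ℝ → ℝ := fun ω => 2 * (noiseDensity p μ ω * γ ω ^ 2) with hd₂
  have hd₁c : Continuous d₁ := by fun_prop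
  have hd₁pos : ∀ ω, 0 < d₁ ω := fun ω => mul_pos (hkpos ω) (by have := hγpos ω; positivity)
  have hd₂pos : ∀ ω, 0 ≤ d₂ ω := fun ω => by
    have := noiseDensity_nonneg (p := p) hμ ω
    simp only [hd₂]; positivity
  have hd₁i : Integrable d₁ ρ := by
    obtain ⟨C, hC⟩ := exists_bound_langevinSymbol_mul_posFT p μ σ gaussian
    refine Integrable.of_bound hd₁c.aestronglyMeasurable (C ^ 2) (Eventually.of_forall fun ω => ?_)
    have := hC ω
    rw [posFT_gaussian, norm_mul, Complex.norm_real, Real.norm_of_nonneg (hγpos ω).le] at this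
    rw [Real.norm_of_nonneg (hd₁pos ω).le]
    simp only [hd₁]
    rw [← mul_pow]
    gcongr
  have hd₂i : Integrable d₂ := (integrable_noiseDensity_mul p μ).const_mul 2
  have hd₂m : Measurable d₂ := by
    have := measurable_noiseDensity p μ
    fun_prop
  have hfin₁ : IsFiniteMeasure (ρ.withDensity fun ω => ENNReal.ofReal (d₁ ω)) :=
    isFiniteMeasure_withDensity_ofReal hd₁i.2
  have hfin₂ : IsFiniteMeasure ((volume : Measure ℝ).withDensity fun ω => ENNReal.ofReal (d₂ ω)) :=
    isFiniteMeasure_withDensity_ofReal hd₂i.2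
  have hm₁ : Measurable fun ω => ENNReal.ofReal (d₁ ω) := hd₁c.measurable.ennreal_ofReal
  have hm₂ : Measurable fun ω => ENNReal.ofReal (d₂ ω) := hd₂m.ennreal_ofReal
  have hcf : ∀ (ν : Measure ℝ) (d : ℝ → ℝ), Measurable d → (∀ ω, 0 ≤ d ω) → ∀ a : ℝ,
      charFun (ν.withDensity fun ω => ENNReal.ofReal (d ω)) a =
        ∫ ω : ℝ, Complex.exp (a * ω * Complex.I) * (d ω : ℂ) ∂ν := fun ν d hd hd0 a => by
    rw [charFun_apply_real, integral_withDensity_eq_integral_toReal_smul hd.ennreal_ofReal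
      (by simp)]
    congr 1; ext ω
    rw [ENNReal.toReal_ofReal (hd0 ω), Complex.real_smul, mul_comm]
  -- Translating the second test function by `a` multiplies its transform by `e^{iωa}`, so the force
  -- correlation is a characteristic function at `a`, computed once from the dynamics and once from
  -- the noise.
  have heq : (ρ.withDensity fun ω => ENNReal.ofReal (d₁ ω)) =
      (volume : Measure ℝ).withDensity fun ω => ENNReal.ofReal (d₂ ω) := by
    refine Measure.ext_of_charFun (funext fun a => ?_)
    rw [hcf ρ d₁ hd₁c.measurable (fun ω => (hd₁pos ω).le), hcf volume d₂ hd₂m hd₂pos,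
      ← hf.expect_circ hσ a, hr.expect_force hσ hρ]
    congr 1; ext ω
    have h1 : posFT (SchwartzMap.compSubConstCLM ℝ a gaussian) ω =
        Complex.exp (ω * a * Complex.I) * posFT gaussian ω := posFT_comp_sub gaussian a ω
    rw [h1, posFT_gaussian, map_mul, Complex.conj_ofReal]
    have h2 := Complex.conj_mul' (langevinSymbol p μ σ ω)
    simp only [hd₁, hγ]
    push_cast
    rw [mul_comm (a : ℂ)]
    linear_combination (-(Complex.exp (ω * a * Complex.I)) *
      ((Real.sqrt (2 * Real.pi) : ℂ) * Complex.exp (-(ω ^ 2 / 2))) ^ 2) * h2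
  have hq : Measurable fun ω => u ω / ENNReal.ofReal (d₁ ω) := hu.div hm₁
  have h1 := lintegral_withDensity_eq_lintegral_mul ρ hm₁ hq
  have h2 := lintegral_withDensity_eq_lintegral_mul volume hm₂ hq
  rw [heq, h2] at h1
  have hne : ∀ ω, ENNReal.ofReal (d₁ ω) ≠ 0 := fun ω => by simpa using hd₁pos ω
  calc ∫⁻ ω, u ω ∂ρ = ∫⁻ ω, ((fun ω => ENNReal.ofReal (d₁ ω)) *
        fun ω => u ω / ENNReal.ofReal (d₁ ω)) ω ∂ρ := by
        congr 1; ext ω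
        rw [Pi.mul_apply, ENNReal.mul_div_cancel (hne ω) ENNReal.ofReal_ne_top]
    _ = _ := h1.symm
    _ = _ := by
        congr 1; ext ω
        rw [Pi.mul_apply, mul_comm, ENNReal.div_eq_inv_mul, mul_comm _ (u ω), mul_assoc,
          ← ENNReal.ofReal_inv_of_pos (hd₁pos ω), ← ENNReal.ofReal_mul (by
            have := hd₁pos ω; positivity)]
        congr 2
        have := (hγpos ω).ne'
        have := (hkpos ω).ne'
        simp only [hd₁, hd₂]
        field_simp

end Identify

/-! ### Spectral measures and mean-square increments of the position. -/

section Stationary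

variable {A : Type*} [Ring A] [StarRing A] [Algebra ℂ A] [StarModule ℂ A]
  {E : QuantumState A} {p : Params} {μ : FrictionKernel} {f : Fin 2 → 𝓢(ℝ, ℝ) →ₗ[ℝ] A}
  {r : Fin 2 → ℝ → A}

/-- The circular components of the position have a spectral measure. -/
theorem IsSteadyState.exists_spectralMeasure (hr : IsSteadyState p μ E f r) (σ : ℝ) :
    ∃ ρ : Measure ℝ, IsFiniteMeasure ρ ∧
      ∀ s t, E.expect (star (circ σ fun i => r i s) * circ σ fun i => r i t) =
        charFun ρ (t - s) := by
  obtain ⟨H, _, _, _, ι, hι⟩ := E.exists_gns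
  have hcont : ∀ i, Continuous fun t => ι (r i t) := fun i => by
    rw [continuous_iff_continuousAt]
    intro t
    rw [ContinuousAt, tendsto_iff_norm_sub_tendsto_zero]
    have h := (hr.continuous i t).sqrt
    rw [Real.sqrt_zero] at h
    refine h.congr fun s => ?_
    rw [← map_sub, @norm_eq_sqrt_re_inner ℂ, hι]
    rfl
  have hexp : ∀ s t, E.expect (star (circ σ fun i => r i s) * circ σ fun i => r i t) =
      E.expect (r 0 s * r 0 t) + Complex.I * σ * E.expect (r 0 s * r 1 t)
      - Complex.I * σ * (E.expect (r 1 s * r 0 t) + Complex.I * σ * E.expect (r 1 s * r 1 t)) := by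
    intro s t
    simp only [circ, star_add, star_smul, (hr.selfAdjoint _ _).star_eq, add_mul, mul_add,
      smul_mul_assoc, mul_smul_comm, map_add, map_smul, smul_eq_mul, RCLike.star_def, map_mul,
      Complex.conj_I, Complex.conj_ofReal]
    ring
  obtain ⟨ρ, hρf, hρ⟩ := exists_charFun_eq_correlation
    (Z := fun t => ι (circ σ fun i => r i t))
    (c := fun τ => E.expect (star (circ σ fun i => r i 0) * circ σ fun i => r i τ))
    (by
      have h0 := hcont 0
      have h1 := hcont 1
      simp only [circ, map_add, map_smul]
      exact h0.add (h1.const_smul _))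
    (fun s t => by
      have hs : ∀ i j, E.expect (r i s * r j t) = E.expect (r i 0 * r j (t - s)) := fun i j => by
        have := hr.stationary i j 0 (t - s) s
        rwa [zero_add, sub_add_cancel] at this
      rw [hι, hexp, hexp]
      simp only [hs])
  refine ⟨ρ, hρf, fun s t => ?_⟩
  rw [hρ, hexp, hexp]
  have hs : ∀ i j, E.expect (r i s * r j t) = E.expect (r i 0 * r j (t - s)) := fun i j => by
    have := hr.stationary i j 0 (t - s) s
    rwa [zero_add, sub_add_cancel] at this
  simp only [hs]

omit [StarRing A] [StarModule ℂ A] in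
theorem circ_sub (σ : ℝ) (u v : Fin 2 → A) : circ σ (fun i => u i - v i) = circ σ u - circ σ v := by
  simp only [circ, smul_sub]; abel

/-- A parallelogram law: the cross terms of the two helicities cancel. -/
theorem sum_meanSq_eq_circ (E : QuantumState A) (u : Fin 2 → A) :
    ∑ i, E.meanSq (u i) = (E.meanSq (circ 1 u) + E.meanSq (circ (-1) u)) / 2 := by
  have h : E.expect (star (circ 1 u) * circ 1 u) + E.expect (star (circ (-1) u) * circ (-1) u) =
      2 * (E.expect (star (u 0) * u 0) + E.expect (star (u 1) * u 1)) := by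
    have h2 := Complex.I_sq
    simp only [circ, star_add, star_smul, add_mul, mul_add,
      smul_mul_assoc, mul_smul_comm, map_add, map_smul, smul_eq_mul, RCLike.star_def, map_mul,
      Complex.conj_I, Complex.ofReal_neg, map_neg, Complex.ofReal_one, map_one]
    linear_combination (-2 * E.expect (star (u 1) * u 1)) * h2
  simp only [E.expect_star_mul_self] at h
  have h' : E.meanSq (circ 1 u) + E.meanSq (circ (-1) u) =
      2 * (E.meanSq (u 0) + E.meanSq (u 1)) := by
    simpa using congrArg Complex.re h
  rw [Fin.sum_univ_two, h']
  ring

theorem meanSq_real_smul (E : QuantumState A) (k : ℝ) (a : A) :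
    E.meanSq ((k : ℂ) • a) = k ^ 2 * E.meanSq a := by
  have : E.expect (star ((k : ℂ) • a) * ((k : ℂ) • a)) = ((k ^ 2 : ℝ) : ℂ) * E.expect (star a * a) := by
    simp only [star_smul, smul_mul_assoc, mul_smul_comm, map_smul, smul_eq_mul, RCLike.star_def,
      Complex.conj_ofReal]
    push_cast; ring
  rw [QuantumState.meanSq, this, Complex.re_ofReal_mul]
  rfl

omit [StarModule ℂ A] in
/-- Mean square increments in terms of the spectral measure. -/
theorem ofReal_meanSq_increment {z : ℝ → A} {ρ : Measure ℝ} [IsFiniteMeasure ρ]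
    (hρ : ∀ s t, E.expect (star (z s) * z t) = charFun ρ (t - s)) (t h : ℝ) :
    ENNReal.ofReal (E.meanSq (z (t + h) - z t)) =
      ∫⁻ ω, ENNReal.ofReal (2 * (1 - Real.cos (h * ω))) ∂ρ := by
  have hi : ∀ h : ℝ, Integrable (fun ω : ℝ => Complex.exp (h * ω * Complex.I)) ρ := fun h =>
    Integrable.of_bound (Continuous.aestronglyMeasurable (by fun_prop)) 1
      (Eventually.of_forall fun ω => (norm_exp_mul_mul_I h ω).le)
  have hre : ∀ h : ℝ, (charFun ρ h).re = ∫ ω, Real.cos (h * ω) ∂ρ := fun h => by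
    rw [charFun_apply_real]
    have : (∫ ω : ℝ, Complex.exp (h * ω * Complex.I) ∂ρ).re =
        ∫ ω : ℝ, (Complex.exp (h * ω * Complex.I)).re ∂ρ := (integral_re (hi h)).symm
    rw [this]
    congr 1; ext ω
    rw [← Complex.ofReal_mul, Complex.exp_ofReal_mul_I_re]
  have hcos : ∀ h : ℝ, Integrable (fun ω => Real.cos (h * ω)) ρ := fun h =>
    Integrable.of_bound (Continuous.aestronglyMeasurable (by fun_prop)) 1
      (Eventually.of_forall fun ω => by simpa using Real.abs_cos_le_one _)
  have h1 : E.meanSq (z (t + h) - z t) = ∫ ω, 2 * (1 - Real.cos (h * ω)) ∂ρ := by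
    have e : E.expect (star (z (t + h) - z t) * (z (t + h) - z t)) =
        charFun ρ 0 - charFun ρ (-h) - charFun ρ h + charFun ρ 0 := by
      have e1 : star (z (t + h) - z t) * (z (t + h) - z t) = star (z (t + h)) * z (t + h)
          - star (z (t + h)) * z t - star (z t) * z (t + h) + star (z t) * z t := by
        rw [star_sub, sub_mul, mul_sub, mul_sub]; abel
      rw [e1, map_add, map_sub, map_sub, hρ, hρ, hρ, hρ]
      simp
    rw [QuantumState.meanSq, e]
    simp only [Complex.add_re, Complex.sub_re, hre]
    rw [integral_const_mul, integral_sub (integrable_const _) (hcos h)]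
    have : ∀ ω, Real.cos (-h * ω) = Real.cos (h * ω) := fun ω => by rw [neg_mul, Real.cos_neg]
    simp only [this, zero_mul, Real.cos_zero]
    ring
  rw [h1, ofReal_integral_eq_lintegral_ofReal]
  · exact ((integrable_const _).sub (hcos h)).const_mul 2
  · exact Eventually.of_forall fun ω => by
      have := Real.cos_le_one (h * ω)
      simp only [Pi.zero_apply]
      linarith

end Stationary

/-! ### The kinetic energy density and its symmetrization. -/

section Density

variable {p : Params} {μ : FrictionKernel}

/-- The sign of `ωc` in `relaxation` is that of helicity `σ = -1`; the denominator is the squared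
symbol divided by `m²`. -/
theorem relaxation_eq (ω : ℝ) :
    relaxation p μ ω = p.m * (μ.ft ω).re / ‖langevinSymbol p μ (-1) ω‖ ^ 2 := by
  have hm := p.m_pos.ne'
  have hc := p.c_pos.ne'
  have hg : gammaFT p μ ω = ((p.m⁻¹ : ℝ) : ℂ) * μ.ft ω := by
    rw [gammaFT]; push_cast; rw [div_eq_inv_mul]
  rw [relaxation, hg, Complex.re_ofReal_mul, Complex.im_ofReal_mul, Complex.sq_norm,
    Complex.normSq_apply, re_langevinSymbol, im_langevinSymbol, Params.ωc]
  have e : (p.m * (p.ω₀ ^ 2 - ω ^ 2) - -1 * (p.e / p.c * p.B) * ω - ω * (μ.ft ω).im) *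
      (p.m * (p.ω₀ ^ 2 - ω ^ 2) - -1 * (p.e / p.c * p.B) * ω - ω * (μ.ft ω).im) +
      ω * (μ.ft ω).re * (ω * (μ.ft ω).re) = p.m ^ 2 *
      ((ω ^ 2 - p.ω₀ ^ 2 - ω * (p.e * p.B / (p.m * p.c)) + ω * (p.m⁻¹ * (μ.ft ω).im)) ^ 2 +
        (ω * (p.m⁻¹ * (μ.ft ω).re)) ^ 2) := by
    field_simp; ring
  rw [e, mul_div_mul_comm p.m, mul_div_assoc]
  congr 1
  field_simp

/-- The kernel and the field are real, so conjugation reverses frequency and helicity together.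
Hence `Φ(-ω)` is the contribution of `σ = 1`. -/
theorem norm_langevinSymbol_neg (σ ω : ℝ) :
    ‖langevinSymbol p μ (-σ) (-ω)‖ = ‖langevinSymbol p μ σ ω‖ := by
  have : langevinSymbol p μ (-σ) (-ω) = conj (langevinSymbol p μ σ ω) := by
    apply Complex.ext
    · rw [Complex.conj_re, re_langevinSymbol, re_langevinSymbol, ft_neg, Complex.conj_im]; ring
    · rw [Complex.conj_im, im_langevinSymbol, im_langevinSymbol, ft_neg, Complex.conj_re]; ring
  rw [this, RCLike.norm_conj]

theorem relaxation_neg_eq (ω : ℝ) :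
    relaxation p μ (-ω) = p.m * (μ.ft ω).re / ‖langevinSymbol p μ 1 ω‖ ^ 2 := by
  rw [relaxation_eq, ft_neg, Complex.conj_re, norm_langevinSymbol_neg]

variable (p μ)

/-- The spectral density of the kinetic energy, before symmetrization in the frequency. -/
def kineticDensity (ω : ℝ) : ℝ :=
  1 / (2 * Real.pi) * (p.ħ * ω / 2 * (coth (p.ħ * ω / (2 * p.kB * p.T)) + 1) * ω ^ 2 *
    (relaxation p μ ω + relaxation p μ (-ω)))

variable {p μ}

theorem kineticDensity_eq (ω : ℝ) : kineticDensity p μ ω = p.m / 2 * ω ^ 2 *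
    (noiseDensity p μ ω / ‖langevinSymbol p μ 1 ω‖ ^ 2 +
      noiseDensity p μ ω / ‖langevinSymbol p μ (-1) ω‖ ^ 2) := by
  rw [kineticDensity, relaxation_eq, relaxation_neg_eq, noiseDensity]
  ring

/-- The `+ 1` coming from the commutator contributes an odd function of `ω` and cancels, while the
`coth` part is even. -/
theorem kineticDensity_add_neg (ω : ℝ) :
    kineticDensity p μ ω + kineticDensity p μ (-ω) = 2 * energyDensity p μ ω := by
  have : p.ħ * -ω / (2 * p.kB * p.T) = -(p.ħ * ω / (2 * p.kB * p.T)) := by ring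
  simp only [kineticDensity, energyDensity, bathEnergy, this, coth_neg, neg_neg]
  ring

variable (p μ) in
theorem measurable_relaxation : Measurable (relaxation p μ) := by
  have h := continuous_ft μ
  have h1 : Measurable fun ω => (gammaFT p μ ω).re := by
    unfold gammaFT; exact (Complex.continuous_re.comp (h.div_const _)).measurable
  have h2 : Measurable fun ω => (gammaFT p μ ω).im := by
    unfold gammaFT; exact (Complex.continuous_im.comp (h.div_const _)).measurable
  unfold relaxation
  fun_prop

variable (p μ) in
theorem measurable_kineticDensity : Measurable (kineticDensity p μ) := by
  have h1 := measurable_relaxation p μ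
  have h2 := measurable_coth_comp p
  have h3 : Measurable fun ω => relaxation p μ (-ω) := h1.comp measurable_neg
  unfold kineticDensity
  fun_prop

variable (p μ) in
theorem measurable_energyDensity : Measurable (energyDensity p μ) := by
  have h1 := measurable_relaxation p μ
  have h2 := measurable_coth_comp p
  have h3 : Measurable fun ω => relaxation p μ (-ω) := h1.comp measurable_neg
  unfold energyDensity bathEnergy
  fun_prop

theorem kineticDensity_nonneg (hμ : ∀ ω : ℝ, ω ≠ 0 → 0 < (μ.ft ω).re) (ω : ℝ) :
    0 ≤ kineticDensity p μ ω := by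
  rw [kineticDensity_eq]
  have := noiseDensity_nonneg (p := p) hμ ω
  have := p.m_pos
  positivity

theorem energyDensity_nonneg (hμ : ∀ ω : ℝ, ω ≠ 0 → 0 < (μ.ft ω).re) (ω : ℝ) :
    0 ≤ energyDensity p μ ω := by
  have h := kineticDensity_add_neg (p := p) (μ := μ) ω
  have h1 := kineticDensity_nonneg (p := p) hμ ω
  have h2 := kineticDensity_nonneg (p := p) hμ (-ω)
  linarith

/-- Reflection invariance of Lebesgue measure, applied in `[0, ∞]` because both sides may be
infinite. -/
theorem lintegral_kineticDensity (hμ : ∀ ω : ℝ, ω ≠ 0 → 0 < (μ.ft ω).re) :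
    ∫⁻ ω, ENNReal.ofReal (kineticDensity p μ ω) = ∫⁻ ω, ENNReal.ofReal (energyDensity p μ ω) := by
  have hm := (measurable_kineticDensity p μ).ennreal_ofReal
  have h1 : ∫⁻ ω, ENNReal.ofReal (kineticDensity p μ (-ω)) =
      ∫⁻ ω, ENNReal.ofReal (kineticDensity p μ ω) :=
    lintegral_neg_eq_self (fun ω => ENNReal.ofReal (kineticDensity p μ ω))
  have h2 : 2 * ∫⁻ ω, ENNReal.ofReal (kineticDensity p μ ω) =
      2 * ∫⁻ ω, ENNReal.ofReal (energyDensity p μ ω) := by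
    rw [two_mul]
    conv_lhs => rw [← h1]
    rw [h1]
    conv_lhs => enter [2]; rw [← h1]
    rw [← lintegral_add_left hm, ← lintegral_const_mul 2
      (measurable_energyDensity p μ).ennreal_ofReal]
    congr 1; ext ω
    rw [← ENNReal.ofReal_add (kineticDensity_nonneg hμ _) (kineticDensity_nonneg hμ _),
      kineticDensity_add_neg, ENNReal.ofReal_mul (by norm_num)]
    simp
  exact (ENNReal.mul_right_inj (by norm_num) (by norm_num)).mp h2

end Density

/-! ### Kinetic energy as the limit of difference quotients. -/

theorem tendsto_lintegral_of_tendsto_of_le {α ι : Type*} [MeasurableSpace α] {m : Measure α}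
    {l : Filter ι} [l.IsCountablyGenerated] {F : ι → α → ENNReal} {G : α → ENNReal}
    (hF : ∀ i, Measurable (F i)) (hle : ∀ i x, F i x ≤ G x)
    (hlim : ∀ x, Tendsto (fun i => F i x) l (𝓝 (G x))) :
    Tendsto (fun i => ∫⁻ x, F i x ∂m) l (𝓝 (∫⁻ x, G x ∂m)) := by
  rcases l.eq_or_neBot with rfl | hl
  · exact tendsto_bot
  refine tendsto_of_le_liminf_of_limsup_le ?_ ?_
  · calc ∫⁻ x, G x ∂m = ∫⁻ x, liminf (fun i => F i x) l ∂m := by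
          congr 1; ext x; exact (hlim x).liminf_eq.symm
      _ ≤ _ := lintegral_liminf_le hF
  · exact limsup_le_of_le (h := Eventually.of_forall fun i => lintegral_mono (hle i))

section Main

variable {A : Type*} [Ring A] [StarRing A] [Algebra ℂ A] [StarModule ℂ A]
  {E : QuantumState A} {p : Params} {μ : FrictionKernel} {f : Fin 2 → 𝓢(ℝ, ℝ) →ₗ[ℝ] A}
  {r : Fin 2 → ℝ → A}

/-- With `x = hω`, division by `h²` leaves `ω²` times a factor at most `1` that tends to `1`. The
integrands thus stay below their limit, so Fatou and monotonicity give convergence without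
integrability. -/
theorem two_mul_one_sub_cos (x : ℝ) : 2 * (1 - Real.cos x) = x ^ 2 * Real.sinc (x / 2) ^ 2 := by
  rcases eq_or_ne x 0 with h | h
  · simp [h]
  have h1 : Real.cos x = 1 - 2 * Real.sin (x / 2) ^ 2 := by
    have := Real.cos_two_mul (x / 2)
    rw [mul_div_cancel₀ x two_ne_zero] at this
    rw [this, Real.cos_sq']; ring
  rw [h1, Real.sinc_of_ne_zero (by positivity)]
  field_simp
  ring

/-- The kinetic energy of the difference quotients as a spectral integral. -/
theorem ofReal_kineticEnergy_diffQuot (hμ : ∀ ω : ℝ, ω ≠ 0 → 0 < (μ.ft ω).re)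
    (hf : IsThermalNoise p μ E f) (hr : IsSteadyState p μ E f r) (t : ℝ) {h : ℝ} (hh : h ≠ 0) :
    ENNReal.ofReal (p.m / 2 * ∑ i : Fin 2, E.meanSq (diffQuot r i t h)) =
      ∫⁻ ω, ENNReal.ofReal (Real.sinc (h * ω / 2) ^ 2 * kineticDensity p μ ω) := by
  have hm := p.m_pos
  -- The factor `m/4` is `m/2` halved by the average over helicities; the `2` in the spectral
  -- density of `ρ` restores `m/2`.
  have key : ∀ σ : ℝ, σ ^ 2 = 1 →
      ENNReal.ofReal (p.m / 4 * (h⁻¹) ^ 2 *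
        E.meanSq ((circ σ fun i => r i (t + h)) - circ σ fun i => r i t)) =
      ∫⁻ ω, ENNReal.ofReal (Real.sinc (h * ω / 2) ^ 2 * (p.m / 2 * ω ^ 2 *
        (noiseDensity p μ ω / ‖langevinSymbol p μ σ ω‖ ^ 2))) := fun σ hσ => by
    obtain ⟨ρ, hρf, hρ⟩ := hr.exists_spectralMeasure σ
    have hu : Measurable fun ω => ENNReal.ofReal (2 * (1 - Real.cos (h * ω))) := by fun_prop
    have hkc := (continuous_langevinSymbol p μ σ).measurable
    have hn := measurable_noiseDensity p μ
    rw [ENNReal.ofReal_mul (by positivity),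
      ofReal_meanSq_increment (z := fun t => circ σ fun i => r i t) hρ t h,
      lintegral_spectralMeasure hμ hf hr hσ hρ hu, ← lintegral_const_mul _ (by fun_prop)]
    congr 1; ext ω
    have h1 : 0 ≤ 2 * (1 - Real.cos (h * ω)) := by linarith [Real.cos_le_one (h * ω)]
    rw [← ENNReal.ofReal_mul h1, ← ENNReal.ofReal_mul (by positivity), two_mul_one_sub_cos]
    congr 1
    field_simp
    ring
  have hsum : p.m / 2 * ∑ i : Fin 2, E.meanSq (diffQuot r i t h) =
      p.m / 4 * (h⁻¹) ^ 2 * E.meanSq ((circ 1 fun i => r i (t + h)) - circ 1 fun i => r i t) +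
      p.m / 4 * (h⁻¹) ^ 2 *
        E.meanSq ((circ (-1) fun i => r i (t + h)) - circ (-1) fun i => r i t) := by
    simp only [diffQuot, meanSq_real_smul]
    rw [← Finset.mul_sum, sum_meanSq_eq_circ E (fun i => r i (t + h) - r i t), circ_sub, circ_sub]
    ring
  have hn0 := noiseDensity_nonneg (p := p) hμ
  have hmeas : Measurable fun ω => ENNReal.ofReal (Real.sinc (h * ω / 2) ^ 2 * (p.m / 2 * ω ^ 2 *
        (noiseDensity p μ ω / ‖langevinSymbol p μ 1 ω‖ ^ 2))) := by
    have hkc := (continuous_langevinSymbol p μ 1).measurable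
    have hn := measurable_noiseDensity p μ
    have hs := Real.continuous_sinc.measurable
    fun_prop
  rw [hsum, ENNReal.ofReal_add
    (mul_nonneg (by positivity) (E.meanSq_nonneg _)) (mul_nonneg (by positivity)
      (E.meanSq_nonneg _)), key 1 (by norm_num), key (-1) (by norm_num), ← lintegral_add_left hmeas]
  congr 1; ext ω
  have := hn0 ω
  rw [← ENNReal.ofReal_add (by positivity) (by positivity), kineticDensity_eq]
  congr 1; ring

theorem tendsto_kineticEnergy_diffQuot (hμ : ∀ ω : ℝ, ω ≠ 0 → 0 < (μ.ft ω).re)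
    (hf : IsThermalNoise p μ E f) (hr : IsSteadyState p μ E f r) (t : ℝ) :
    Tendsto (fun h : ℝ => ENNReal.ofReal (p.m / 2 * ∑ i : Fin 2, E.meanSq (diffQuot r i t h)))
      (𝓝[≠] 0) (𝓝 (∫⁻ ω, ENNReal.ofReal (energyDensity p μ ω))) := by
  rw [← lintegral_kineticDensity hμ]
  have hs := Real.continuous_sinc
  have h : Tendsto (fun h : ℝ => ∫⁻ ω, ENNReal.ofReal (Real.sinc (h * ω / 2) ^ 2 *
      kineticDensity p μ ω)) (𝓝[≠] 0) (𝓝 (∫⁻ ω, ENNReal.ofReal (kineticDensity p μ ω))) := by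
    refine tendsto_lintegral_of_tendsto_of_le (fun h => ?_) (fun h ω => ?_) fun ω => ?_
    · have := measurable_kineticDensity p μ
      have := hs.measurable
      fun_prop
    · refine ENNReal.ofReal_le_ofReal (mul_le_of_le_one_left (kineticDensity_nonneg hμ ω) ?_)
      rw [sq_le_one_iff_abs_le_one]
      exact Real.abs_sinc_le_one _
    · refine ENNReal.tendsto_ofReal (Tendsto.mono_left ?_ nhdsWithin_le_nhds)
      have hc : Continuous fun h : ℝ => Real.sinc (h * ω / 2) ^ 2 * kineticDensity p μ ω := by
        fun_prop
      simpa using hc.tendsto 0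
  refine h.congr' ?_
  filter_upwards [self_mem_nhdsWithin] with h hh
  exact (ofReal_kineticEnergy_diffQuot hμ hf hr t hh).symm

end Main

end Magneto

end
/-- In a steady state of the quantum Langevin equation with thermal noise at temperature `T`:
whenever the velocity `v = ṙ` exists as a mean-square derivative, its mean kinetic energy is the
(convergent) integral of `(1/2π) ℰ_k(ω) ω² [Φ(ω) + Φ(-ω)]`; and in general, with the velocity
approximated by difference quotients, the same formula holds in `[0, ∞]`. -/
theorem theorem1 {A : Type*} [Ring A] [StarRing A] [Algebra ℂ A] [StarModule ℂ A]
    (E : Magneto.QuantumState A) (p : Magneto.Params) (μ : Magneto.FrictionKernel)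
    (hμ : ∀ ω : ℝ, ω ≠ 0 → 0 < (μ.ft ω).re)
    (f : Fin 2 → 𝓢(ℝ, ℝ) →ₗ[ℝ] A) (hf : Magneto.IsThermalNoise p μ E f)
    (r : Fin 2 → ℝ → A) (hr : Magneto.IsSteadyState p μ E f r) :
    (∀ v : Fin 2 → ℝ → A, Magneto.IsVelocity E r v →
      Integrable (Magneto.energyDensity p μ) ∧
      ∀ t : ℝ, Magneto.kineticEnergy p E v t = ((∫ ω, Magneto.energyDensity p μ ω : ℝ) : ℂ)) ∧
    (∀ t : ℝ, Tendsto
      (fun h : ℝ => ENNReal.ofReal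
        (p.m / 2 * ∑ i : Fin 2, E.meanSq (Magneto.diffQuot r i t h)))
      (𝓝[≠] 0) (𝓝 (∫⁻ ω, ENNReal.ofReal (Magneto.energyDensity p μ ω)))) := by
  refine ⟨fun v hv => ?_, Magneto.tendsto_kineticEnergy_diffQuot hμ hf hr⟩
  have hnn := Magneto.energyDensity_nonneg (p := p) hμ
  have hm := Magneto.measurable_energyDensity p μ
  have hvel : ∀ t, ENNReal.ofReal (p.m / 2 * ∑ i : Fin 2, E.meanSq (v i t)) =
      ∫⁻ ω, ENNReal.ofReal (Magneto.energyDensity p μ ω) := fun t => by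
    -- The quotients also converge in mean square to `v`, so the limit in `[0, ∞]` is a finite
    -- energy; integrability of the density follows.
    refine tendsto_nhds_unique (ENNReal.tendsto_ofReal (Tendsto.const_mul _ ?_))
      (Magneto.tendsto_kineticEnergy_diffQuot hμ hf hr t)
    exact tendsto_finsetSum _ fun i _ => E.tendsto_meanSq (hv.hasDeriv i t)
  have hint : Integrable (Magneto.energyDensity p μ) := by
    refine ⟨hm.aestronglyMeasurable, ?_⟩
    rw [hasFiniteIntegral_iff_ofReal (Eventually.of_forall hnn), ← hvel 0]
    exact ENNReal.ofReal_lt_top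
  refine ⟨hint, fun t => ?_⟩
  have h := hvel t
  rw [← ofReal_integral_eq_lintegral_ofReal hint (Eventually.of_forall hnn),
    ENNReal.ofReal_eq_ofReal_iff (mul_nonneg (by have := p.m_pos; positivity)
      (Finset.sum_nonneg fun i _ => E.meanSq_nonneg _)) (integral_nonneg hnn)] at h
  have hsq : ∀ i, E.expect (v i t ^ 2) = (E.meanSq (v i t) : ℂ) := fun i => by
    rw [← E.expect_star_mul_self, (hv.selfAdjoint i t).star_eq, sq]
  rw [Magneto.kineticEnergy, map_add, hsq, hsq, ← h, Fin.sum_univ_two]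
  push_cast
  ring
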